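/- Let $d\ge 2$ and $0<s<\frac d2$. For $\alpha\in(0,d)$ let $I_\alpha(x)=A_\alpha|x|^{\alpha-d}$, $A_\alpha=\frac{\Gamma((d-\alpha)/2)}{\pi^{d/2}2^{\alpha}\Gamma(\alpha/2)}$, be the Riesz kernel on $\mathbb R^d$, and let $$\mathcal D_{2s}(f,f)=\int_{\mathbb R^d}(I_{2s}*f)(x)\,f(x)\,dx .$$ Let $\mathring H^s(\mathbb R^d)$ be the Hilbert space of real functions $u\in L^{\frac{2d}{d-2s}}(\mathbb R^d)$ whose (distributional) Fourier transform $\hat u$ is a locally integrable function and satisfies $\|u\|_{\mathring H^s}^2=\int_{\mathbb R^d}|\xi|^{2s}|\hat u(\xi)|^2\,d\xi<\infty$, where the Fourier transform is normalized by $\hat u(\xi)=(2\pi)^{-d/2}\int_{\mathbb R^d} e^{-ix\cdot\xi}u(x)\,dx$, with inner product $\langle u,v\rangle_{\mathring H^s}=\int_{\mathbb R^d}|\xi|^{2s}\hat u(\xi)\overline{\hat v(\xi)}\,d\xi$, and let $\mathring H^{-s}(\mathbb R^d)$ be its dual space with the dual norm. Let $T\in L^1_{loc}(\mathbb R^d)$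 be real-valued with $\mathcal D_{2s}(|T|,|T|)<\infty$. Then the integral $(I_{2s}*T)(x)$ converges absolutely for almost every $x$, the function $(I_{2s}*T)\,T$ is integrable, and the following hold. 1. $T$ generates a bounded linear functional on $\mathring H^s(\mathbb R^d)$: $C_c^\infty(\mathbb R^d)\subset\mathring H^s(\mathbb R^d)$, and the functional $\varphi\mapsto\int_{\mathbb R^d}T\varphi\,dx$ on $C_c^\infty(\mathbb R^d)$ has a unique continuous linear extension to $\mathring H^s(\mathbb R^d)$, again denoted by $T\in\mathring H^{-s}(\mathbb R^d)$. 2. There is a unique $U_T\in\mathring H^s(\mathbb R^d)$ with $\langle T,v\rangle=\langle U_T,v\rangle_{\mathring H^s}$ for all $v\in\mathring H^s(\mathbb R^d)$, and $U_T=I_{2s}*T$ almost everywhere. 3. $\|T\|_{\mathring H^{-s}}^2=\mathcal D_{2s}(T,T)$. -/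

import Mathlib

open MeasureTheory Set Filter
open scoped ENNReal ContDiff SchwartzMap FourierTransform ComplexConjugate

noncomputable section

/-! ### Riesz potentials and the Coulomb type energy on `ℝᵈ` -/

/-- The Riesz kernel `I_α(x) = A_α |x|^(α - d)` with
`A_α = Γ((d - α)/2) / (π^(d/2) 2^α Γ(α/2))`. -/
def rieszKernel (d : ℕ) (α : ℝ) (x : EuclideanSpace ℝ (Fin d)) : ℝ :=
  Real.Gamma ((d - α) / 2) / (Real.pi ^ ((d : ℝ) / 2) * 2 ^ α * Real.Gamma (α / 2))
    * ‖x‖ ^ (α - d)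

/-- The Riesz potential `(I_α * f)(x) = ∫ I_α(x - y) f(y) dy`. -/
def rieszPotential {d : ℕ} (α : ℝ) (f : EuclideanSpace ℝ (Fin d) → ℝ)
    (x : EuclideanSpace ℝ (Fin d)) : ℝ :=
  ∫ y, rieszKernel d α (x - y) * f y

/-- The energy `𝓓_α(f, f) = ∫ (I_α * f)(x) f(x) dx`. -/
def rieszEnergy {d : ℕ} (α : ℝ) (f : EuclideanSpace ℝ (Fin d) → ℝ) : ℝ :=
  ∫ x, rieszPotential α f x * f x

/-- The energy `𝓓_α(|f|, |f|) = ∫ (I_α * |f|)(x) |f(x)| dx`, an element of `[0, ∞]`. -/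
def rieszAbsEnergy {d : ℕ} (α : ℝ) (f : EuclideanSpace ℝ (Fin d) → ℝ) : ℝ≥0∞ :=
  ∫⁻ x, (∫⁻ y, ENNReal.ofReal (rieszKernel d α (x - y)) * ENNReal.ofReal |f y|)
    * ENNReal.ofReal |f x|

/-! ### The homogeneous fractional Sobolev space -/

/-- `u` and the locally integrable function `g` are regular tempered distributions, and `g` is the
distributional Fourier transform of `u` (in the normalization `∫ e^(-2πi⟨x, ξ⟩) u(x) dx`),
that is, `⟨g, φ⟩ = ⟨u, 𝓕 φ⟩` for every Schwartz function `φ`. -/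
def IsDistribFourier {d : ℕ} (u : EuclideanSpace ℝ (Fin d) → ℝ)
    (g : EuclideanSpace ℝ (Fin d) → ℂ) : Prop :=
  LocallyIntegrable g ∧
  ∀ φ : 𝓢(EuclideanSpace ℝ (Fin d), ℂ),
    Integrable (fun x => (u x : ℂ) * (𝓕 φ : 𝓢(EuclideanSpace ℝ (Fin d), ℂ)) x) ∧
    Integrable (fun ξ => g ξ * φ ξ) ∧
    ∫ ξ, g ξ * φ ξ = ∫ x, (u x : ℂ) * (𝓕 φ : 𝓢(EuclideanSpace ℝ (Fin d), ℂ)) x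

/-- The real functions `u` with finite `(∫ |ξ|^(2s) |û(ξ)|² dξ)^(1/2)`, where `û` is a function and
`û(ξ) = (2π)^(-d/2) ∫ e^(-i⟨x, ξ⟩) u(x) dx`. In terms of the Fourier transform `g` of Mathlib
one has `û(ξ) = (2π)^(-d/2) g(ξ/(2π))`, so the square of this norm is
`∫ (2π|ξ|)^(2s) |g(ξ)|² dξ`. -/
def HasFiniteHomNorm {d : ℕ} (s : ℝ) (u : EuclideanSpace ℝ (Fin d) → ℝ) : Prop :=
  ∃ g : EuclideanSpace ℝ (Fin d) → ℂ, IsDistribFourier u g ∧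
    Integrable (fun ξ => (2 * Real.pi * ‖ξ‖) ^ (2 * s) * ‖g ξ‖ ^ 2)

section helpers

variable {d : ℕ} {s : ℝ} {u v : EuclideanSpace ℝ (Fin d) → ℝ}
  {g h k : EuclideanSpace ℝ (Fin d) → ℂ}

theorem IsDistribFourier.unique (hg : IsDistribFourier u g) (hh : IsDistribFourier u h) :
    g =ᵐ[volume] h := by
  refine ae_eq_of_integral_contDiff_smul_eq hg.1 hh.1 fun f hf hfc => ?_
  have h1 : HasCompactSupport (fun x => (f x : ℂ)) :=
    hfc.comp_left (g := fun r : ℝ => (r : ℂ)) rfl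
  have h2 : ContDiff ℝ ∞ (fun x => (f x : ℂ)) := Complex.ofRealCLM.contDiff.comp hf
  have e := ((hg.2 (h1.toSchwartzMap h2)).2.2).trans ((hh.2 (h1.toSchwartzMap h2)).2.2).symm
  simpa [mul_comm, Complex.real_smul] using e

theorem IsDistribFourier.congr (huv : u =ᵐ[volume] v) (hg : IsDistribFourier u g) :
    IsDistribFourier v g := by
  refine ⟨hg.1, fun φ => ?_⟩
  obtain ⟨a, b, c⟩ := hg.2 φ
  have e : (fun x => (u x : ℂ) * (𝓕 φ : 𝓢(EuclideanSpace ℝ (Fin d), ℂ)) x) =ᵐ[volume]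
      fun x => (v x : ℂ) * (𝓕 φ : 𝓢(EuclideanSpace ℝ (Fin d), ℂ)) x := by
    filter_upwards [huv] with x hx
    rw [hx]
  exact ⟨a.congr e, b, c.trans (integral_congr_ae e)⟩

theorem IsDistribFourier.add (hg : IsDistribFourier u g) (hh : IsDistribFourier v h) :
    IsDistribFourier (u + v) (g + h) := by
  refine ⟨hg.1.add hh.1, fun φ => ?_⟩
  obtain ⟨a, b, c⟩ := hg.2 φ
  obtain ⟨a', b', c'⟩ := hh.2 φ
  refine ⟨?_, ?_, ?_⟩
  · refine (a.add a').congr (Eventually.of_forall fun x => ?_)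
    simp [add_mul]
  · refine (b.add b').congr (Eventually.of_forall fun x => ?_)
    simp [add_mul]
  · simp only [Pi.add_apply, Complex.ofReal_add, add_mul]
    rw [integral_add b b', integral_add a a', c, c']

theorem IsDistribFourier.smul (r : ℝ) (hg : IsDistribFourier u g) :
    IsDistribFourier (r • u) (r • g) := by
  refine ⟨hg.1.smul r, fun φ => ?_⟩
  obtain ⟨a, b, c⟩ := hg.2 φ
  refine ⟨?_, ?_, ?_⟩
  · simpa [mul_assoc] using a.const_mul (r : ℂ)
  · simpa [mul_assoc, Complex.real_smul] using b.const_mul (r : ℂ)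
  · simp only [Pi.smul_apply, smul_eq_mul, Complex.ofReal_mul, Complex.real_smul, mul_assoc]
    rw [integral_const_mul, integral_const_mul, c]

theorem IsDistribFourier.zero : IsDistribFourier (d := d) 0 0 :=
  ⟨locallyIntegrable_zero, fun φ => by simp⟩

theorem integrable_weight_mul
    (hg : AEStronglyMeasurable g) (hh : AEStronglyMeasurable h)
    (ig : Integrable (fun ξ => (2 * Real.pi * ‖ξ‖) ^ (2 * s) * ‖g ξ‖ ^ 2))
    (ih : Integrable (fun ξ => (2 * Real.pi * ‖ξ‖) ^ (2 * s) * ‖h ξ‖ ^ 2)) :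
    Integrable (fun ξ => (2 * Real.pi * ‖ξ‖) ^ (2 * s) * (g ξ * conj (h ξ)).re) := by
  have hw : Measurable fun ξ : EuclideanSpace ℝ (Fin d) => (2 * Real.pi * ‖ξ‖) ^ (2 * s) := by
    fun_prop
  refine (ig.add ih).mono' ?_ (Eventually.of_forall fun ξ => ?_)
  · exact hw.aestronglyMeasurable.mul (Complex.continuous_re.comp_aestronglyMeasurable
      (hg.mul (Complex.continuous_conj.comp_aestronglyMeasurable hh)))
  · have w0 : (0 : ℝ) ≤ (2 * Real.pi * ‖ξ‖) ^ (2 * s) := by positivity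
    have h1 : |(g ξ * conj (h ξ)).re| ≤ ‖g ξ‖ * ‖h ξ‖ := by
      refine (Complex.abs_re_le_norm _).trans ?_
      simp
    rw [Real.norm_eq_abs, abs_mul, abs_of_nonneg w0, Pi.add_apply, ← mul_add]
    refine mul_le_mul_of_nonneg_left (h1.trans ?_) w0
    nlinarith [sq_nonneg (‖g ξ‖ - ‖h ξ‖), sq_nonneg (‖g ξ‖ + ‖h ξ‖)]

theorem HasFiniteHomNorm.congr (huv : u =ᵐ[volume] v) (hu : HasFiniteHomNorm s u) :
    HasFiniteHomNorm s v := by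
  obtain ⟨g, hg, ig⟩ := hu
  exact ⟨g, hg.congr huv, ig⟩

theorem HasFiniteHomNorm.add (hu : HasFiniteHomNorm s u) (hv : HasFiniteHomNorm s v) :
    HasFiniteHomNorm s (u + v) := by
  obtain ⟨g, hg, ig⟩ := hu
  obtain ⟨h, hh, ih⟩ := hv
  refine ⟨g + h, hg.add hh, ?_⟩
  have i3 := (integrable_weight_mul hg.1.aestronglyMeasurable hh.1.aestronglyMeasurable ig
    ih).const_mul 2
  refine ((ig.add ih).add i3).congr (Eventually.of_forall fun ξ => ?_)
  have e : ‖g ξ + h ξ‖ ^ 2 = ‖g ξ‖ ^ 2 + ‖h ξ‖ ^ 2 + 2 * (g ξ * conj (h ξ)).re := by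
    simp only [← Complex.normSq_eq_norm_sq, Complex.normSq_add]
  simp only [Pi.add_apply, e]
  ring

theorem HasFiniteHomNorm.smul (r : ℝ) (hu : HasFiniteHomNorm s u) :
    HasFiniteHomNorm s (r • u) := by
  obtain ⟨g, hg, ig⟩ := hu
  refine ⟨r • g, hg.smul r, (ig.const_mul (r ^ 2)).congr (Eventually.of_forall fun ξ => ?_)⟩
  simp only [Pi.smul_apply, norm_smul, mul_pow, Real.norm_eq_abs, sq_abs]
  ring

end helpers

/-- `{u ∈ L^p(ℝᵈ) : ‖u‖_{H̊ˢ} < ∞}` with `p = 2d/(d - 2s)`, as a subspace of `L^p(ℝᵈ)`. -/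
def homSobolevSubmodule (d : ℕ) (s : ℝ) :
    Submodule ℝ (Lp (α := EuclideanSpace ℝ (Fin d)) ℝ
      (ENNReal.ofReal (2 * d / (d - 2 * s))) volume) where
  carrier := {u | HasFiniteHomNorm s u}
  add_mem' := fun {u v} hu hv => (HasFiniteHomNorm.add hu hv).congr (Lp.coeFn_add u v).symm
  zero_mem' := HasFiniteHomNorm.congr (Lp.coeFn_zero ℝ _ volume).symm
    ⟨0, IsDistribFourier.zero, by simp⟩
  smul_mem' := fun r u hu => (HasFiniteHomNorm.smul r hu).congr (Lp.coeFn_smul r u).symm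

/-- The homogeneous fractional Sobolev space `H̊ˢ(ℝᵈ)` (for `0 < s < d/2`) of real functions,
with the inner product `∫ |ξ|^(2s) û(ξ) conj(v̂(ξ)) dξ` that is defined below. -/
def HomSobolev (d : ℕ) (s : ℝ) : Type := homSobolevSubmodule d s

namespace HomSobolev

variable {d : ℕ} {s : ℝ}

instance : AddCommGroup (HomSobolev d s) := inferInstanceAs (AddCommGroup (homSobolevSubmodule d s))

instance : Module ℝ (HomSobolev d s) := inferInstanceAs (Module ℝ (homSobolevSubmodule d s))

/-- The element of `L^p(ℝᵈ)` underlying an element of `H̊ˢ(ℝᵈ)`. -/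
def toLp (u : HomSobolev d s) : Lp (α := EuclideanSpace ℝ (Fin d)) ℝ
    (ENNReal.ofReal (2 * d / (d - 2 * s))) volume :=
  Subtype.val (p := fun u => u ∈ homSobolevSubmodule d s) u

/-- The function (defined up to null sets) underlying an element of `H̊ˢ(ℝᵈ)`. -/
instance : CoeFun (HomSobolev d s) (fun _ => EuclideanSpace ℝ (Fin d) → ℝ) :=
  ⟨fun u => u.toLp⟩

theorem hasFiniteHomNorm (u : HomSobolev d s) : HasFiniteHomNorm s u :=
  Subtype.property (p := fun u => u ∈ homSobolevSubmodule d s) u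

/-- The Fourier transform of an element of `H̊ˢ(ℝᵈ)`, a function determined up to null sets. -/
def fourier (u : HomSobolev d s) : EuclideanSpace ℝ (Fin d) → ℂ :=
  u.hasFiniteHomNorm.choose

theorem isDistribFourier_fourier (u : HomSobolev d s) : IsDistribFourier u u.fourier :=
  u.hasFiniteHomNorm.choose_spec.1

theorem integrable_fourier (u : HomSobolev d s) :
    Integrable (fun ξ => (2 * Real.pi * ‖ξ‖) ^ (2 * s) * ‖u.fourier ξ‖ ^ 2) :=
  u.hasFiniteHomNorm.choose_spec.2

theorem fourier_add (u v : HomSobolev d s) :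
    (u + v).fourier =ᵐ[volume] u.fourier + v.fourier :=
  (u + v).isDistribFourier_fourier.unique <|
    (u.isDistribFourier_fourier.add v.isDistribFourier_fourier).congr
      (Lp.coeFn_add u.toLp v.toLp).symm

theorem fourier_smul (r : ℝ) (u : HomSobolev d s) :
    (r • u).fourier =ᵐ[volume] r • u.fourier :=
  (r • u).isDistribFourier_fourier.unique <|
    (u.isDistribFourier_fourier.smul r).congr (Lp.coeFn_smul r u.toLp).symm

/-- `⟨u, v⟩ = ∫ |ξ|^(2s) û(ξ) conj(v̂(ξ)) dξ`, written with the Fourier transform of Mathlib. For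
real functions `u`, `v` this integral is real, since then the real part of the integrand is even
and its imaginary part is odd; so only the real part is integrated. -/
def innerProd (u v : HomSobolev d s) : ℝ :=
  ∫ ξ, (2 * Real.pi * ‖ξ‖) ^ (2 * s) * (u.fourier ξ * conj (v.fourier ξ)).re

theorem integrable_innerProd (u v : HomSobolev d s) :
    Integrable (fun ξ => (2 * Real.pi * ‖ξ‖) ^ (2 * s) * (u.fourier ξ * conj (v.fourier ξ)).re) :=
  integrable_weight_mul u.isDistribFourier_fourier.1.aestronglyMeasurable
    v.isDistribFourier_fourier.1.aestronglyMeasurable u.integrable_fourier v.integrable_fourier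

/-- The inner product makes `H̊ˢ(ℝᵈ)` a (semi-)inner product space. -/
abbrev core (d : ℕ) (s : ℝ) : PreInnerProductSpace.Core ℝ (HomSobolev d s) where
  inner := innerProd
  conj_inner_symm u v := by
    simp only [innerProd, conj_trivial]
    congr 1
    funext ξ
    simp only [Complex.mul_re, Complex.conj_re, Complex.conj_im]
    ring
  re_inner_nonneg u := by
    simp only [innerProd, RCLike.re_to_real]
    refine integral_nonneg fun ξ => mul_nonneg (by positivity) ?_
    rw [Complex.mul_conj]
    exact Complex.normSq_nonneg _
  add_left u v w := by
    simp only [innerProd]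
    rw [← integral_add (u.integrable_innerProd w) (v.integrable_innerProd w)]
    refine integral_congr_ae ?_
    filter_upwards [fourier_add u v] with ξ hξ
    rw [hξ, Pi.add_apply, add_mul, Complex.add_re, mul_add]
  smul_left u v r := by
    simp only [innerProd, conj_trivial]
    rw [← integral_const_mul]
    refine integral_congr_ae ?_
    filter_upwards [fourier_smul r u] with ξ hξ
    rw [hξ, Pi.smul_apply, Complex.real_smul, mul_assoc (r : ℂ), Complex.re_ofReal_mul]
    ring

/-- The norm `‖u‖ = ⟨u, u⟩^(1/2) = (∫ |ξ|^(2s) |û(ξ)|² dξ)^(1/2)`. -/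
instance : SeminormedAddCommGroup (HomSobolev d s) :=
  @InnerProductSpace.Core.toSeminormedAddCommGroup ℝ (HomSobolev d s) _ _ _ (core d s)

instance : InnerProductSpace ℝ (HomSobolev d s) :=
  InnerProductSpace.ofCore (core d s)

theorem inner_def (u v : HomSobolev d s) :
    inner ℝ u v =
      ∫ ξ, (2 * Real.pi * ‖ξ‖) ^ (2 * s) * (u.fourier ξ * conj (v.fourier ξ)).re := rfl

theorem norm_sq_eq (u : HomSobolev d s) :
    ‖u‖ ^ 2 = ∫ ξ, (2 * Real.pi * ‖ξ‖) ^ (2 * s) * ‖u.fourier ξ‖ ^ 2 := by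
  rw [← real_inner_self_eq_norm_sq, inner_def]
  congr 1
  funext ξ
  rw [Complex.mul_conj, Complex.ofReal_re, Complex.normSq_eq_norm_sq]

/-- The element `L` of the dual `H̊⁻ˢ(ℝᵈ)` is an extension of the functional `φ ↦ ∫ T φ` on
`C_c^∞(ℝᵈ)`; in particular the test functions belong to `H̊ˢ(ℝᵈ)`. -/
def Extends (L : StrongDual ℝ (HomSobolev d s)) (T : EuclideanSpace ℝ (Fin d) → ℝ) : Prop :=
  ∀ φ : EuclideanSpace ℝ (Fin d) → ℝ, ContDiff ℝ ∞ φ → HasCompactSupport φ →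
    ∃ u : HomSobolev d s, u =ᵐ[volume] φ ∧ L u = ∫ x, T x * φ x

end HomSobolev

end

/-!
The Riesz kernel is a superposition of heat kernels, `I_{2s} = Γ(s)⁻¹ ∫₀^∞ t^(s-1) e^(tΔ) dt`. For
`f ≥ 0`, the square function `G = ∫₀^∞ t^(s-1) (e^(tΔ) f)² dt` thus has integral proportional to
`𝓓_{2s}(f, f)`; splitting the superposition at a well-chosen time bounds a power of `I_{2s} * f` by
`G`, whence `I_{2s} * f ∈ L^(2d/(d-2s))`. For integrable `S` of finite energy, the superposition
also gives `𝓓_{2s}(S, S) = ∫ |ξ|^(-2s) |Ŝ|²`, so `|ξ|^(-s) Ŝ` has `L²` norm `𝓓_{2s}(S, S)^(1/2)`.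

If `T` has finite energy, dominated convergence shows that the energies of the differences of its
truncations `Tₙ` to balls tend to zero. Hence `|ξ|^(-s) T̂ₙ` converges in `L²` to some `h`, and
`|ξ|^(-s) h` is the Fourier transform of `U = I_{2s} * T`. So `U ∈ H̊ˢ(ℝᵈ)` with
`‖U‖² = ‖h‖² = 𝓓_{2s}(T, T)`, and pairing with a test function before passing to the limit shows
that `⟨U, ·⟩` extends `T`. Uniqueness is the density of the test functions in `H̊ˢ(ℝᵈ)`.
-/

section RieszPotential

variable {d : ℕ} {s : ℝ}

local notation "𝔼" n:max => EuclideanSpace ℝ (Fin n)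

/-! ### Heat kernel and Riesz kernel -/

/-- The Gauss–Weierstrass kernel `(4πt)^(-d/2) exp(-|x|²/(4t))` of the heat semigroup `e^(tΔ)` on
`ℝᵈ`, meaningful for `t > 0`. The Riesz kernels are its Mellin transforms in `t`. -/
noncomputable def heatKernel (d : ℕ) (t : ℝ) (x : 𝔼 d) : ℝ :=
  (4 * Real.pi * t) ^ (-(d : ℝ) / 2) * Real.exp (-‖x‖ ^ 2 / (4 * t))

theorem heatKernel_nonneg {t : ℝ} (ht : 0 ≤ t) (x : 𝔼 d) : 0 ≤ heatKernel d t x := by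
  unfold heatKernel; positivity

theorem heatKernel_sub_comm (t : ℝ) (x y : 𝔼 d) :
    heatKernel d t (x - y) = heatKernel d t (y - x) := by
  simp only [heatKernel, norm_sub_rev x y]

@[fun_prop]
theorem measurable_heatKernel {α : Type*} [MeasurableSpace α] {τ : α → ℝ} {g : α → 𝔼 d}
    (hτ : Measurable τ) (hg : Measurable g) : Measurable fun a => heatKernel d (τ a) (g a) := by
  unfold heatKernel; fun_prop

theorem heatKernel_mul_heatKernel {t : ℝ} (ht : 0 < t) (x y z : 𝔼 d) :
    heatKernel d t (x - z) * heatKernel d t (z - y) =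
      heatKernel d (2 * t) (x - y) * heatKernel d (t / 2) (z - (1 / 2 : ℝ) • (x + y)) := by
  set m := (1 / 2 : ℝ) • (x + y) with hm
  have hpar : ‖x - z‖ ^ 2 + ‖z - y‖ ^ 2 = ‖x - y‖ ^ 2 / 2 + 2 * ‖z - m‖ ^ 2 := by
    have h := parallelogram_law_with_norm ℝ (x - z) (z - y)
    rw [sub_add_sub_cancel, show x - z - (z - y) = (-2 : ℝ) • (z - m) by rw [hm]; module,
      norm_smul] at h
    norm_num at h
    linarith
  have hexp : Real.exp (-‖x - z‖ ^ 2 / (4 * t)) * Real.exp (-‖z - y‖ ^ 2 / (4 * t)) =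
      Real.exp (-‖x - y‖ ^ 2 / (4 * (2 * t))) * Real.exp (-‖z - m‖ ^ 2 / (4 * (t / 2))) := by
    rw [← Real.exp_add, ← Real.exp_add]
    congr 1
    field_simp
    linarith
  have hpow : (4 * Real.pi * t) ^ (-(d : ℝ) / 2) * (4 * Real.pi * t) ^ (-(d : ℝ) / 2) =
      (4 * Real.pi * (2 * t)) ^ (-(d : ℝ) / 2) * (4 * Real.pi * (t / 2)) ^ (-(d : ℝ) / 2) := by
    rw [← Real.mul_rpow (by positivity) (by positivity),
      ← Real.mul_rpow (by positivity) (by positivity)]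
    ring_nf
  simp only [heatKernel]
  rw [mul_mul_mul_comm, hexp, hpow]
  ring

theorem integrable_exp_neg_mul_sq_norm {V : Type*} [NormedAddCommGroup V] [InnerProductSpace ℝ V]
    [FiniteDimensional ℝ V] [MeasurableSpace V] [BorelSpace V] {b : ℝ} (hb : 0 < b) :
    Integrable fun v : V => Real.exp (-b * ‖v‖ ^ 2) := by
  refine (GaussianFourier.integrable_cexp_neg_mul_sq_norm_add (V := V) (b := b)
    (by simpa) 0 0).norm.congr (ae_of_all _ fun v => ?_)
  simp [Complex.norm_exp, ← Complex.ofReal_pow]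

theorem lintegral_heatKernel {t : ℝ} (ht : 0 < t) :
    ∫⁻ x : 𝔼 d, ENNReal.ofReal (heatKernel d t x) = 1 := by
  have hb : 0 < 1 / (4 * t) := by positivity
  have hexp : ∀ x : 𝔼 d, Real.exp (-‖x‖ ^ 2 / (4 * t)) = Real.exp (-(1 / (4 * t)) * ‖x‖ ^ 2) :=
    fun x => by ring_nf
  simp only [heatKernel, hexp]
  rw [← ofReal_integral_eq_lintegral_ofReal ((integrable_exp_neg_mul_sq_norm hb).const_mul _)
    (ae_of_all _ fun x => by positivity), integral_const_mul,
    GaussianFourier.integral_rexp_neg_mul_sq_norm hb, finrank_euclideanSpace_fin,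
    show Real.pi / (1 / (4 * t)) = 4 * Real.pi * t by field_simp,
    ← Real.rpow_add (by positivity), neg_div, neg_add_cancel, Real.rpow_zero, ENNReal.ofReal_one]

theorem lintegral_heatKernel_mul_heatKernel {t : ℝ} (ht : 0 < t) (x y : 𝔼 d) :
    ∫⁻ z, ENNReal.ofReal (heatKernel d t (x - z)) * ENNReal.ofReal (heatKernel d t (z - y)) =
      ENNReal.ofReal (heatKernel d (2 * t) (x - y)) := by
  simp_rw [← ENNReal.ofReal_mul (heatKernel_nonneg ht.le _), heatKernel_mul_heatKernel ht,
    ENNReal.ofReal_mul (heatKernel_nonneg (by positivity : 0 ≤ 2 * t) _)]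
  rw [lintegral_const_mul _ (by fun_prop),
    lintegral_sub_right_eq_self fun z : 𝔼 d => ENNReal.ofReal (heatKernel d (t / 2) z),
    lintegral_heatKernel (half_pos ht), mul_one]

theorem heatKernel_mono {r t : ℝ} (hr : 0 < r) (hrt : r ≤ t) (x : 𝔼 d) :
    (t / r) ^ (-(d : ℝ) / 2) * heatKernel d r x ≤ heatKernel d t x := by
  have ht := hr.trans_le hrt
  rw [heatKernel, heatKernel, ← mul_assoc, ← Real.mul_rpow (by positivity) (by positivity),
    show t / r * (4 * Real.pi * r) = 4 * Real.pi * t by field_simp]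
  simp only [neg_div]
  gcongr

theorem rieszKernel_nonneg {α : ℝ} (hα : 0 ≤ α) (hαd : α ≤ d) (x : 𝔼 d) :
    0 ≤ rieszKernel d α x := by
  have := Real.Gamma_nonneg_of_nonneg (by linarith : 0 ≤ ((d : ℝ) - α) / 2)
  have := Real.Gamma_nonneg_of_nonneg (by linarith : 0 ≤ α / 2)
  unfold rieszKernel; positivity

@[fun_prop]
theorem measurable_rieszKernel {α : Type*} [MeasurableSpace α] {β : ℝ} {g : α → 𝔼 d}
    (hg : Measurable g) : Measurable fun a => rieszKernel d β (g a) := by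
  unfold rieszKernel; fun_prop

/-! ### Subordination of the Riesz kernel to the heat kernel -/

theorem rpow_mul_exp_neg_div_eq (a b : ℝ) {t : ℝ} (ht : 0 < t) :
    (|(-1 : ℝ)| * t ^ ((-1 : ℝ) - 1)) •
        ((t ^ (-1 : ℝ)) ^ (a - 1) * Real.exp (-(b * t ^ (-1 : ℝ)))) =
      t ^ (-a - 1) * Real.exp (-(b / t)) := by
  rw [abs_neg, abs_one, one_mul, smul_eq_mul, ← mul_assoc, ← Real.rpow_mul ht.le,
    ← Real.rpow_add ht, Real.rpow_neg_one, div_eq_mul_inv]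
  ring_nf

theorem integrableOn_rpow_mul_exp_neg_div {a b : ℝ} (ha : 0 < a) (hb : 0 < b) :
    IntegrableOn (fun t : ℝ => t ^ (-a - 1) * Real.exp (-(b / t))) (Ioi 0) := by
  have h : IntegrableOn (fun t : ℝ => t ^ (a - 1) * Real.exp (-(b * t))) (Ioi 0) := by
    simpa using integrableOn_rpow_mul_exp_neg_mul_rpow (s := a - 1) (by linarith) one_pos hb
  exact ((integrableOn_Ioi_comp_rpow_iff _ (by norm_num)).2 h).congr_fun
    (fun t ht => rpow_mul_exp_neg_div_eq a b ht) measurableSet_Ioi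

theorem integral_rpow_mul_exp_neg_div {a b : ℝ} (ha : 0 < a) (hb : 0 < b) :
    ∫ t in Ioi (0 : ℝ), t ^ (-a - 1) * Real.exp (-(b / t)) = (1 / b) ^ a * Real.Gamma a := by
  rw [← Real.integral_rpow_mul_exp_neg_mul_Ioi ha hb,
    ← integral_comp_rpow_Ioi (fun t : ℝ => t ^ (a - 1) * Real.exp (-(b * t)))
      (by norm_num : (-1 : ℝ) ≠ 0)]
  exact setIntegral_congr_fun measurableSet_Ioi fun t ht => (rpow_mul_exp_neg_div_eq a b ht).symm

theorem rpow_mul_heatKernel_eq {c t : ℝ} (hc : 0 < c) (ht : 0 < t) (x : 𝔼 d) :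
    t ^ (s - 1) * heatKernel d (c * t) x = (4 * Real.pi * c) ^ (-(d : ℝ) / 2) *
      (t ^ (-((d : ℝ) / 2 - s) - 1) * Real.exp (-(‖x‖ ^ 2 / (4 * c) / t))) := by
  have hpow : t ^ (-((d : ℝ) / 2 - s) - 1) = t ^ (s - 1) * t ^ (-(d : ℝ) / 2) := by
    rw [← Real.rpow_add ht]; ring_nf
  have hexp : -‖x‖ ^ 2 / (4 * (c * t)) = -(‖x‖ ^ 2 / (4 * c) / t) := by field_simp
  rw [heatKernel, ← mul_assoc (4 * Real.pi), Real.mul_rpow (by positivity) ht.le, hpow, hexp]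
  ring

theorem Gamma_mul_rieszKernel (hs : 0 < s) {c : ℝ} (hc : 0 < c) {x : 𝔼 d} (hx : x ≠ 0) :
    c ^ (-s) * Real.Gamma s * rieszKernel d (2 * s) x = (4 * Real.pi * c) ^ (-(d : ℝ) / 2) *
      ((1 / (‖x‖ ^ 2 / (4 * c))) ^ ((d : ℝ) / 2 - s) * Real.Gamma ((d : ℝ) / 2 - s)) := by
  have hr : 0 < ‖x‖ := norm_pos_iff.2 hx
  set r := ‖x‖ with hx'
  have hG : Real.Gamma s ≠ 0 := (Real.Gamma_pos_of_pos hs).ne'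
  have hbase : (1 / (r ^ 2 / (4 * c))) ^ ((d : ℝ) / 2 - s) =
      (4 * c) ^ ((d : ℝ) / 2 - s) * r ^ (2 * s - d) := by
    rw [one_div_div, Real.div_rpow (by positivity) (by positivity), div_eq_mul_inv,
      ← Real.rpow_natCast r, ← Real.rpow_mul hr.le, ← Real.rpow_neg hr.le]
    congr 2
    push_cast
    ring
  have hfour : (4 * c) ^ (-s) = (2 ^ (2 * s))⁻¹ * c ^ (-s) := by
    rw [Real.mul_rpow (by norm_num) hc.le, ← Real.rpow_neg (by norm_num),
      show (4 : ℝ) = 2 ^ (2 : ℝ) by norm_num, ← Real.rpow_mul (by norm_num), mul_neg]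
  have hpow : (4 * Real.pi * c) ^ (-(d : ℝ) / 2) * (4 * c) ^ ((d : ℝ) / 2 - s) =
      (Real.pi ^ ((d : ℝ) / 2))⁻¹ * ((2 ^ (2 * s))⁻¹ * c ^ (-s)) := by
    rw [← hfour, ← Real.rpow_neg Real.pi_pos.le, show 4 * Real.pi * c = Real.pi * (4 * c) by ring,
      Real.mul_rpow Real.pi_pos.le (by positivity), mul_assoc, ← Real.rpow_add (by positivity)]
    ring_nf
  rw [hbase, rieszKernel, ← hx', show 2 * s / 2 = s by ring,
    show ((d : ℝ) - 2 * s) / 2 = d / 2 - s by ring]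
  calc _ = (Real.pi ^ ((d : ℝ) / 2))⁻¹ * ((2 ^ (2 * s))⁻¹ * c ^ (-s)) *
        (r ^ (2 * s - d) * Real.Gamma (d / 2 - s)) := by field_simp
    _ = _ := by rw [← hpow]; ring

theorem integrableOn_rpow_mul_heatKernel (hsd : s < (d : ℝ) / 2) {c : ℝ} (hc : 0 < c) {x : 𝔼 d}
    (hx : x ≠ 0) : IntegrableOn (fun t : ℝ => t ^ (s - 1) * heatKernel d (c * t) x) (Ioi 0) := by
  have hb : 0 < ‖x‖ ^ 2 / (4 * c) := by have := norm_pos_iff.2 hx; positivity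
  exact IntegrableOn.congr_fun
    ((integrableOn_rpow_mul_exp_neg_div (sub_pos.2 hsd) hb).const_mul _)
    (fun t ht => (rpow_mul_heatKernel_eq hc ht x).symm) measurableSet_Ioi

theorem integral_rpow_mul_heatKernel (hs : 0 < s) (hsd : s < (d : ℝ) / 2) {c : ℝ} (hc : 0 < c)
    {x : 𝔼 d} (hx : x ≠ 0) :
    ∫ t in Ioi (0 : ℝ), t ^ (s - 1) * heatKernel d (c * t) x =
      c ^ (-s) * Real.Gamma s * rieszKernel d (2 * s) x := by
  rw [Gamma_mul_rieszKernel hs hc hx,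
    ← integral_rpow_mul_exp_neg_div (sub_pos.2 hsd) (by positivity), ← integral_const_mul]
  exact setIntegral_congr_fun measurableSet_Ioi fun t ht => rpow_mul_heatKernel_eq hc ht x

theorem lintegral_rpow_mul_heatKernel (hs : 0 < s) (hsd : s < (d : ℝ) / 2) {c : ℝ} (hc : 0 < c)
    {x : 𝔼 d} (hx : x ≠ 0) :
    ∫⁻ t in Ioi (0 : ℝ), ENNReal.ofReal (t ^ (s - 1)) * ENNReal.ofReal (heatKernel d (c * t) x) =
      ENNReal.ofReal (c ^ (-s) * Real.Gamma s) * ENNReal.ofReal (rieszKernel d (2 * s) x) := by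
  rw [← ENNReal.ofReal_mul (by positivity), ← integral_rpow_mul_heatKernel hs hsd hc hx,
    ofReal_integral_eq_lintegral_ofReal (integrableOn_rpow_mul_heatKernel hsd hc hx)]
  · exact setLIntegral_congr_fun measurableSet_Ioi fun t (ht : 0 < t) =>
      (ENNReal.ofReal_mul (by positivity)).symm
  · exact (ae_restrict_iff' measurableSet_Ioi).2 (ae_of_all _ fun t (ht : 0 < t) =>
      mul_nonneg (by positivity) (heatKernel_nonneg (by positivity) _))

/-! ### Heat extension and energy of a nonnegative function -/

/-- The solution `(e^(tΔ) f)(x)` of the heat equation with initial datum `f ≥ 0`; with values in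
`[0, ∞]`, no integrability of `f` has to be assumed. -/
noncomputable def heatExtension (f : 𝔼 d → ℝ≥0∞) (t : ℝ) (x : 𝔼 d) : ℝ≥0∞ :=
  ∫⁻ y, ENNReal.ofReal (heatKernel d t (x - y)) * f y

/-- The Riesz potential `I_α * f` of `f ≥ 0`, with values in `[0, ∞]`. -/
noncomputable def lrieszPotential (α : ℝ) (f : 𝔼 d → ℝ≥0∞) (x : 𝔼 d) : ℝ≥0∞ :=
  ∫⁻ y, ENNReal.ofReal (rieszKernel d α (x - y)) * f y

/-- The energy `𝓓_α(f, f)` of `f ≥ 0`, with values in `[0, ∞]`. -/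
noncomputable def lrieszEnergy (α : ℝ) (f : 𝔼 d → ℝ≥0∞) : ℝ≥0∞ :=
  ∫⁻ x, lrieszPotential α f x * f x

/-- The quadratic form `⟨e^(tΔ) f, f⟩` of the heat semigroup, for `f ≥ 0`. -/
noncomputable def heatEnergy (f : 𝔼 d → ℝ≥0∞) (t : ℝ) : ℝ≥0∞ :=
  ∫⁻ x, heatExtension f t x * f x

/-- The square function `∫₀^∞ t^(s-1) (e^(tΔ) f)(x)² dt`, whose integral over `x` is a multiple of
the energy `𝓓_{2s}(f, f)`. -/
noncomputable def heatSquareFunction (s : ℝ) (f : 𝔼 d → ℝ≥0∞) (x : 𝔼 d) : ℝ≥0∞ :=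
  ∫⁻ t in Ioi (0 : ℝ), ENNReal.ofReal (t ^ (s - 1)) * heatExtension f t x ^ 2

variable {f : 𝔼 d → ℝ≥0∞}

@[fun_prop]
theorem measurable_heatExtension (hf : Measurable f) {α : Type*} [MeasurableSpace α] {τ : α → ℝ}
    {g : α → 𝔼 d} (hτ : Measurable τ) (hg : Measurable g) :
    Measurable fun a => heatExtension f (τ a) (g a) :=
  Measurable.lintegral_prod_right' (ν := volume) (f := fun p : α × 𝔼 d =>
    ENNReal.ofReal (heatKernel d (τ p.1) (g p.1 - p.2)) * f p.2) (by fun_prop)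

@[fun_prop]
theorem measurable_lrieszPotential (α : ℝ) (hf : Measurable f) :
    Measurable (lrieszPotential α f) :=
  Measurable.lintegral_prod_right' (ν := volume) (f := fun p : 𝔼 d × 𝔼 d =>
    ENNReal.ofReal (rieszKernel d α (p.1 - p.2)) * f p.2) (by fun_prop)

theorem measurable_heatSquareFunction (s : ℝ) (hf : Measurable f) :
    Measurable (heatSquareFunction s f) :=
  Measurable.lintegral_prod_left' (μ := volume.restrict (Ioi 0)) (f := fun p : ℝ × 𝔼 d =>
    ENNReal.ofReal (p.1 ^ (s - 1)) * heatExtension f p.1 p.2 ^ 2) (by fun_prop)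

theorem neZero_of_lt_half (hs : 0 < s) (hsd : s < (d : ℝ) / 2) : NeZero d :=
  ⟨by rintro rfl; norm_num at hsd; linarith⟩

theorem lintegral_rpow_mul_heatExtension (hs : 0 < s) (hsd : s < (d : ℝ) / 2) {c : ℝ}
    (hc : 0 < c) (hf : Measurable f) (x : 𝔼 d) :
    ∫⁻ t in Ioi (0 : ℝ), ENNReal.ofReal (t ^ (s - 1)) * heatExtension f (c * t) x =
      ENNReal.ofReal (c ^ (-s) * Real.Gamma s) * lrieszPotential (2 * s) f x := by
  have := neZero_of_lt_half hs hsd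
  simp_rw [heatExtension, lrieszPotential]
  simp_rw [← lintegral_const_mul' _ _ ENNReal.ofReal_ne_top]
  rw [lintegral_lintegral_swap (by unfold Function.uncurry; fun_prop)]
  refine lintegral_congr_ae ?_
  filter_upwards [Measure.ae_ne volume x] with y hy
  rw [← mul_assoc, ← lintegral_rpow_mul_heatKernel hs hsd hc (sub_ne_zero.2 hy.symm),
    ← lintegral_mul_const _ (by fun_prop)]
  simp_rw [mul_assoc]

theorem lintegral_heatKernel_mul_heatExtension (hf : Measurable f) {t : ℝ} (ht : 0 < t) (x : 𝔼 d) :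
    ∫⁻ z, ENNReal.ofReal (heatKernel d t (x - z)) * heatExtension f t z =
      heatExtension f (2 * t) x := by
  simp_rw [heatExtension]
  simp_rw [← lintegral_const_mul' _ _ ENNReal.ofReal_ne_top]
  rw [lintegral_lintegral_swap (by unfold Function.uncurry; fun_prop)]
  refine lintegral_congr fun y => ?_
  rw [← lintegral_heatKernel_mul_heatKernel ht, ← lintegral_mul_const _ (by fun_prop)]
  simp_rw [mul_assoc]

theorem lintegral_heatExtension_sq (hf : Measurable f) {t : ℝ} (ht : 0 < t) :
    ∫⁻ x, heatExtension f t x ^ 2 = heatEnergy f (2 * t) := by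
  have hsq : ∀ x, heatExtension f t x ^ 2 = ∫⁻ y,
      ENNReal.ofReal (heatKernel d t (x - y)) * f y * heatExtension f t x := fun x => by
    rw [lintegral_mul_const _ (by fun_prop), sq, heatExtension]
  simp_rw [hsq]
  rw [lintegral_lintegral_swap (by unfold Function.uncurry; fun_prop)]
  refine lintegral_congr fun y => ?_
  rw [← lintegral_heatKernel_mul_heatExtension hf ht, ← lintegral_mul_const _ (by fun_prop)]
  refine lintegral_congr fun x => ?_
  rw [heatKernel_sub_comm]
  ring

theorem lintegral_rpow_mul_heatEnergy (hs : 0 < s) (hsd : s < (d : ℝ) / 2) {c : ℝ}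
    (hc : 0 < c) (hf : Measurable f) :
    ∫⁻ t in Ioi (0 : ℝ), ENNReal.ofReal (t ^ (s - 1)) * heatEnergy f (c * t) =
      ENNReal.ofReal (c ^ (-s) * Real.Gamma s) * lrieszEnergy (2 * s) f := by
  simp_rw [heatEnergy, lrieszEnergy]
  simp_rw [← lintegral_const_mul' _ _ ENNReal.ofReal_ne_top]
  rw [lintegral_lintegral_swap (by unfold Function.uncurry; fun_prop)]
  refine lintegral_congr fun x => ?_
  rw [← mul_assoc, ← lintegral_rpow_mul_heatExtension hs hsd hc hf,
    ← lintegral_mul_const _ (by fun_prop)]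
  simp_rw [mul_assoc]

theorem lintegral_heatSquareFunction (hs : 0 < s) (hsd : s < (d : ℝ) / 2) (hf : Measurable f) :
    ∫⁻ x, heatSquareFunction s f x =
      ENNReal.ofReal (2 ^ (-s) * Real.Gamma s) * lrieszEnergy (2 * s) f := by
  simp_rw [heatSquareFunction]
  rw [lintegral_lintegral_swap (by unfold Function.uncurry; fun_prop),
    ← lintegral_rpow_mul_heatEnergy hs hsd two_pos hf]
  refine setLIntegral_congr_fun measurableSet_Ioi fun t ht => ?_
  rw [lintegral_const_mul _ (by fun_prop), lintegral_heatExtension_sq hf ht]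

/-! ### The Hardy–Littlewood–Sobolev bound -/

theorem lintegral_Ioc_rpow (hs : 0 < s) {τ : ℝ} (hτ : 0 ≤ τ) :
    ∫⁻ t in Ioc 0 τ, ENNReal.ofReal (t ^ (s - 1)) = ENNReal.ofReal (τ ^ s / s) := by
  have hint : IntegrableOn (fun t : ℝ => t ^ (s - 1)) (Ioc 0 τ) :=
    (intervalIntegrable_iff_integrableOn_Ioc_of_le hτ).1
      (intervalIntegral.intervalIntegrable_rpow' (by linarith))
  rw [← ofReal_integral_eq_lintegral_ofReal hint, ← intervalIntegral.integral_of_le hτ,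
    integral_rpow (by left; linarith)]
  · simp [Real.zero_rpow hs.ne']
  · exact (ae_restrict_iff' measurableSet_Ioc).2
      (ae_of_all _ fun t ht => Real.rpow_nonneg ht.1.le _)

theorem lintegral_Ioi_rpow {a r : ℝ} (has : s < a) (hr : 0 < r) :
    ∫⁻ t in Ioi r, ENNReal.ofReal (t ^ (s - a - 1)) = ENNReal.ofReal (r ^ (s - a) / (a - s)) := by
  have h : s - a - 1 < -1 := by linarith
  rw [← ofReal_integral_eq_lintegral_ofReal (integrableOn_Ioi_rpow_of_lt h hr),
    integral_Ioi_rpow_of_lt h hr, sub_add_cancel, ← neg_sub a s, neg_div_neg_eq]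
  exact (ae_restrict_iff' measurableSet_Ioi).2
    (ae_of_all _ fun t ht => Real.rpow_nonneg (hr.trans ht).le _)

theorem heatExtension_mono (f : 𝔼 d → ℝ≥0∞) {r t : ℝ} (hr : 0 < r) (hrt : r ≤ t) (x : 𝔼 d) :
    ENNReal.ofReal ((t / r) ^ (-(d : ℝ) / 2)) * heatExtension f r x ≤ heatExtension f t x := by
  have ht := hr.trans_le hrt
  rw [heatExtension, ← lintegral_const_mul' _ _ ENNReal.ofReal_ne_top]
  refine lintegral_mono fun y => ?_
  rw [← mul_assoc, ← ENNReal.ofReal_mul (by positivity)]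
  gcongr
  exact heatKernel_mono hr hrt _

theorem heatEnergy_mono (f : 𝔼 d → ℝ≥0∞) {r t : ℝ} (hr : 0 < r) (hrt : r ≤ t) :
    ENNReal.ofReal ((t / r) ^ (-(d : ℝ) / 2)) * heatEnergy f r ≤ heatEnergy f t := by
  rw [heatEnergy, ← lintegral_const_mul' _ _ ENNReal.ofReal_ne_top]
  refine lintegral_mono fun x => ?_
  rw [← mul_assoc]
  gcongr
  exact heatExtension_mono f hr hrt x

theorem heatEnergy_le (hs : 0 < s) (hsd : s < (d : ℝ) / 2) (hf : Measurable f) {r : ℝ}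
    (hr : 0 < r) :
    ENNReal.ofReal (r ^ s / ((d : ℝ) / 2 - s)) * heatEnergy f r ≤
      ENNReal.ofReal (Real.Gamma s) * lrieszEnergy (2 * s) f := by
  have hpow : ∀ t ∈ Ioi r, ENNReal.ofReal (t ^ (s - 1)) * ENNReal.ofReal ((t / r) ^ (-(d : ℝ) / 2))
      = ENNReal.ofReal (r ^ ((d : ℝ) / 2)) * ENNReal.ofReal (t ^ (s - (d : ℝ) / 2 - 1)) := by
    intro t (ht : r < t)
    have ht0 : 0 < t := hr.trans ht
    rw [← ENNReal.ofReal_mul (by positivity), ← ENNReal.ofReal_mul (by positivity),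
      sub_right_comm, sub_eq_add_neg (s - 1), Real.rpow_add ht0, Real.div_rpow ht0.le hr.le,
      neg_div, Real.rpow_neg hr.le]
    field_simp
  calc ENNReal.ofReal (r ^ s / ((d : ℝ) / 2 - s)) * heatEnergy f r
      = ∫⁻ t in Ioi r, ENNReal.ofReal (t ^ (s - 1)) *
          (ENNReal.ofReal ((t / r) ^ (-(d : ℝ) / 2)) * heatEnergy f r) := by
        simp_rw [← mul_assoc]
        rw [lintegral_mul_const _ (by fun_prop), setLIntegral_congr_fun measurableSet_Ioi hpow,
          lintegral_const_mul _ (by fun_prop), lintegral_Ioi_rpow hsd hr,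
          ← ENNReal.ofReal_mul (by positivity), mul_div_assoc', ← Real.rpow_add hr,
          add_sub_cancel]
    _ ≤ ∫⁻ t in Ioi r, ENNReal.ofReal (t ^ (s - 1)) * heatEnergy f t :=
        setLIntegral_mono' measurableSet_Ioi fun t (ht : r < t) => by
          gcongr; exact heatEnergy_mono f hr ht.le
    _ ≤ ∫⁻ t in Ioi (0 : ℝ), ENNReal.ofReal (t ^ (s - 1)) * heatEnergy f t :=
        lintegral_mono_set (Ioi_subset_Ioi hr.le)
    _ = ENNReal.ofReal (Real.Gamma s) * lrieszEnergy (2 * s) f := by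
        simpa using lintegral_rpow_mul_heatEnergy hs hsd one_pos hf

theorem heatExtension_sq_le (hf : Measurable f) {t : ℝ} (ht : 0 < t) (x : 𝔼 d) :
    heatExtension f t x ^ 2 ≤ ENNReal.ofReal (heatKernel d t 0) * heatEnergy f t := by
  obtain ⟨t, rfl⟩ : ∃ r, t = 2 * r := ⟨t / 2, by ring⟩
  have ht : 0 < t := by linarith
  have hkernel : ∫⁻ z, ENNReal.ofReal (heatKernel d t (x - z)) ^ (2 : ℝ) =
      ENNReal.ofReal (heatKernel d (2 * t) 0) := by
    rw [← sub_self x, ← lintegral_heatKernel_mul_heatKernel ht]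
    refine lintegral_congr fun z => ?_
    rw [heatKernel_sub_comm t z x, ENNReal.rpow_ofNat, sq]
  have hCS := ENNReal.lintegral_mul_le_Lp_mul_Lq (volume : Measure (𝔼 d))
    Real.HolderConjugate.two_two (f := fun z => ENNReal.ofReal (heatKernel d t (x - z)))
    (g := heatExtension f t) (by fun_prop) (by fun_prop)
  rw [hkernel] at hCS
  rw [← lintegral_heatKernel_mul_heatExtension hf ht, ← lintegral_heatExtension_sq hf ht]
  refine (pow_le_pow_left₀ zero_le hCS 2).trans_eq ?_
  rw [mul_pow, ← ENNReal.rpow_natCast, ← ENNReal.rpow_mul, ← ENNReal.rpow_natCast,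
    ← ENNReal.rpow_mul]
  simp

theorem exists_heatEnergy_le (hs : 0 < s) (hsd : s < (d : ℝ) / 2) (hf : Measurable f)
    (hE : lrieszEnergy (2 * s) f ≠ ⊤) :
    ∃ B : ℝ, 0 ≤ B ∧ ∀ t, 0 < t → heatEnergy f t ≤ ENNReal.ofReal (B * t ^ (-s)) := by
  have := sub_pos.2 hsd
  have hG := Real.Gamma_pos_of_pos hs
  refine ⟨Real.Gamma s * (lrieszEnergy (2 * s) f).toReal * ((d : ℝ) / 2 - s), by positivity,
    fun t ht => ?_⟩
  have hpos : 0 < t ^ s / ((d : ℝ) / 2 - s) := by positivity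
  have h := heatEnergy_le hs hsd hf ht
  rw [← ENNReal.ofReal_toReal hE, ← ENNReal.ofReal_mul hG.le, mul_comm,
    ← ENNReal.le_div_iff_mul_le (by left; simpa using hpos) (by left; simp),
    ← ENNReal.ofReal_div_of_pos hpos] at h
  refine h.trans_eq ?_
  rw [Real.rpow_neg ht.le, div_div_eq_mul_div, div_eq_mul_inv]

theorem exists_heatExtension_le (hs : 0 < s) (hsd : s < (d : ℝ) / 2) (hf : Measurable f)
    (hE : lrieszEnergy (2 * s) f ≠ ⊤) :
    ∃ A : ℝ, 0 ≤ A ∧ ∀ t, 0 < t → ∀ x,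
      heatExtension f t x ≤ ENNReal.ofReal (A * t ^ (-((d : ℝ) / 4 + s / 2))) := by
  obtain ⟨B, hB, hle⟩ := exists_heatEnergy_le hs hsd hf hE
  refine ⟨√((4 * Real.pi) ^ (-(d : ℝ) / 2) * B), by positivity, fun t ht x => ?_⟩
  refine (ENNReal.pow_le_pow_left_iff two_ne_zero).1 ?_
  calc heatExtension f t x ^ 2
      ≤ ENNReal.ofReal (heatKernel d t 0) * ENNReal.ofReal (B * t ^ (-s)) :=
        (heatExtension_sq_le hf ht x).trans (by gcongr; exact hle t ht)
    _ = _ := by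
        rw [← ENNReal.ofReal_mul (heatKernel_nonneg ht.le _), ← ENNReal.ofReal_pow (by positivity),
          mul_pow, Real.sq_sqrt (by positivity), ← Real.rpow_mul_natCast ht.le,
          show -((d : ℝ) / 4 + s / 2) * (2 : ℕ) = -(d : ℝ) / 2 + -s by push_cast; ring,
          Real.rpow_add ht, heatKernel, Real.mul_rpow (by positivity) ht.le, norm_zero]
        simp only [ne_eq, OfNat.ofNat_ne_zero, not_false_eq_true, zero_pow, neg_zero, zero_div,
          Real.exp_zero, mul_one]
        ring_nf

theorem le_add_inv_mul_sq {M : ℝ≥0∞} (hM : M ≠ 0) (hM' : M ≠ ⊤) (y : ℝ≥0∞) :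
    y ≤ M + M⁻¹ * y ^ 2 := by
  rcases le_total y M with h | h
  · exact h.trans le_self_add
  · calc y = M⁻¹ * (M * y) := by rw [← mul_assoc, ENNReal.inv_mul_cancel hM hM', one_mul]
      _ ≤ M⁻¹ * y ^ 2 := by rw [sq]; gcongr
      _ ≤ M + M⁻¹ * y ^ 2 := le_add_self

section Interpolation

variable {q : ℝ → ℝ≥0∞} {A a : ℝ}

theorem lintegral_Ioc_rpow_mul_le (hq : Measurable q) (hs : 0 < s) {M τ : ℝ} (hM : 0 < M)
    (hτ : 0 ≤ τ) :
    ∫⁻ t in Ioc 0 τ, ENNReal.ofReal (t ^ (s - 1)) * q t ≤ ENNReal.ofReal (M * (τ ^ s / s)) +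
      ENNReal.ofReal M⁻¹ * ∫⁻ t in Ioi (0 : ℝ), ENNReal.ofReal (t ^ (s - 1)) * q t ^ 2 := by
  calc ∫⁻ t in Ioc 0 τ, ENNReal.ofReal (t ^ (s - 1)) * q t
      ≤ ∫⁻ t in Ioc 0 τ, (ENNReal.ofReal M * ENNReal.ofReal (t ^ (s - 1)) +
          ENNReal.ofReal M⁻¹ * (ENNReal.ofReal (t ^ (s - 1)) * q t ^ 2)) := by
        refine lintegral_mono fun t => ?_
        rw [ENNReal.ofReal_inv_of_pos hM, mul_comm (ENNReal.ofReal M), mul_left_comm, ← mul_add]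
        gcongr
        exact le_add_inv_mul_sq (by simpa using hM) ENNReal.ofReal_ne_top _
    _ = ENNReal.ofReal (M * (τ ^ s / s)) +
          ENNReal.ofReal M⁻¹ * ∫⁻ t in Ioc 0 τ, ENNReal.ofReal (t ^ (s - 1)) * q t ^ 2 := by
        rw [lintegral_add_left (by fun_prop), lintegral_const_mul _ (by fun_prop),
          lintegral_const_mul _ (by fun_prop), lintegral_Ioc_rpow hs hτ, ENNReal.ofReal_mul hM.le]
    _ ≤ _ := by gcongr; exact Ioc_subset_Ioi_self

theorem lintegral_Ioi_rpow_mul_le (has : s < a) (hA : 0 ≤ A) {τ : ℝ} (hτ : 0 < τ)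
    (hqA : ∀ t, 0 < t → q t ≤ ENNReal.ofReal (A * t ^ (-a))) :
    ∫⁻ t in Ioi τ, ENNReal.ofReal (t ^ (s - 1)) * q t ≤
      ENNReal.ofReal (A * (τ ^ (s - a) / (a - s))) := by
  rw [ENNReal.ofReal_mul hA, ← lintegral_Ioi_rpow has hτ, ← lintegral_const_mul _ (by fun_prop)]
  refine setLIntegral_mono' measurableSet_Ioi fun t (ht : τ < t) => ?_
  have ht0 : 0 < t := hτ.trans ht
  calc ENNReal.ofReal (t ^ (s - 1)) * q t
      ≤ ENNReal.ofReal (t ^ (s - 1)) * ENNReal.ofReal (A * t ^ (-a)) := by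
        gcongr; exact hqA t ht0
    _ = ENNReal.ofReal A * ENNReal.ofReal (t ^ (s - a - 1)) := by
        rw [← ENNReal.ofReal_mul (by positivity), ← ENNReal.ofReal_mul hA,
          show s - a - 1 = s - 1 + -a by ring, Real.rpow_add ht0]
        ring_nf

theorem lintegral_rpow_mul_le_of_eq_ofReal (hq : Measurable q) (hs : 0 < s) (has : s < a)
    (hA : 0 ≤ A) (hqA : ∀ t, 0 < t → q t ≤ ENNReal.ofReal (A * t ^ (-a))) {g : ℝ} (hg : 0 < g)
    (hqg : ∫⁻ t in Ioi (0 : ℝ), ENNReal.ofReal (t ^ (s - 1)) * q t ^ 2 = ENNReal.ofReal g) :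
    ∫⁻ t in Ioi (0 : ℝ), ENNReal.ofReal (t ^ (s - 1)) * q t ≤
      ENNReal.ofReal ((1 / s + 1 + A / (a - s)) * g ^ ((a - s) / (2 * a - s))) := by
  have := sub_pos.2 has
  have hden : 0 < 2 * a - s := by linarith
  -- the choice of `τ` that balances the three terms of the bound
  set τ := g ^ (-1 / (2 * a - s)) with hτ
  have hτ0 : 0 < τ := by positivity
  have hpow : τ ^ (s - a) = g ^ ((a - s) / (2 * a - s)) := by
    rw [hτ, ← Real.rpow_mul hg.le]; ring_nf
  have hsmall : τ ^ (-a) * (τ ^ s / s) = 1 / s * τ ^ (s - a) := by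
    rw [sub_eq_neg_add, Real.rpow_add hτ0]; ring
  have hmid : (τ ^ (-a))⁻¹ * g = τ ^ (s - a) := by
    have : g = τ ^ (-(2 * a - s)) := by
      rw [hτ, ← Real.rpow_mul hg.le, div_mul_eq_mul_div, neg_mul_neg, one_mul, div_self hden.ne',
        Real.rpow_one]
    rw [this, ← Real.rpow_neg hτ0.le, ← Real.rpow_add hτ0]
    ring_nf
  rw [← Ioc_union_Ioi_eq_Ioi hτ0.le]
  refine (lintegral_union_le _ _ _).trans <| (add_le_add (lintegral_Ioc_rpow_mul_le hq hs
    (by positivity : 0 < τ ^ (-a)) hτ0.le) (lintegral_Ioi_rpow_mul_le has hA hτ0 hqA)).trans_eq ?_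
  rw [hqg, ← ENNReal.ofReal_mul (by positivity), ← ENNReal.ofReal_add (by positivity)
    (by positivity), ← ENNReal.ofReal_add (by positivity) (by positivity), hsmall, hmid, ← hpow]
  ring_nf

theorem lintegral_rpow_mul_le_rpow (hq : Measurable q) (hs : 0 < s) (has : s < a) (hA : 0 ≤ A)
    (hqA : ∀ t, 0 < t → q t ≤ ENNReal.ofReal (A * t ^ (-a))) :
    ∫⁻ t in Ioi (0 : ℝ), ENNReal.ofReal (t ^ (s - 1)) * q t ≤
      ENNReal.ofReal (1 / s + 1 + A / (a - s)) *
        (∫⁻ t in Ioi (0 : ℝ), ENNReal.ofReal (t ^ (s - 1)) * q t ^ 2) ^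
          ((a - s) / (2 * a - s)) := by
  have := sub_pos.2 has
  have hden : 0 < 2 * a - s := by linarith
  set G := ∫⁻ t in Ioi (0 : ℝ), ENNReal.ofReal (t ^ (s - 1)) * q t ^ 2 with hG
  rcases eq_or_ne G 0 with h0 | h0
  · have hae := (lintegral_eq_zero_iff (by fun_prop)).1 (hG.symm.trans h0)
    refine (lintegral_eq_zero_iff (by fun_prop)).2 ?_ |>.trans_le zero_le
    filter_upwards [hae] with t ht
    simpa using ht
  rcases eq_or_ne G ⊤ with htop | htop
  · rw [htop, ENNReal.top_rpow_of_pos (by positivity), ENNReal.mul_top]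
    · exact le_top
    · have : 0 < 1 / s + 1 + A / (a - s) := by positivity
      simpa using this
  have hg : 0 < G.toReal := ENNReal.toReal_pos h0 htop
  have hGg : G = ENNReal.ofReal G.toReal := (ENNReal.ofReal_toReal htop).symm
  refine (lintegral_rpow_mul_le_of_eq_ofReal hq hs has hA hqA hg hGg).trans_eq ?_
  rw [ENNReal.ofReal_mul (by positivity), ← ENNReal.ofReal_rpow_of_pos hg, ← hGg]

end Interpolation

theorem exists_lrieszPotential_le (hs : 0 < s) (hsd : s < (d : ℝ) / 2) (hf : Measurable f)
    (hE : lrieszEnergy (2 * s) f ≠ ⊤) :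
    ∃ C : ℝ, ∀ x, lrieszPotential (2 * s) f x ≤
      ENNReal.ofReal C * heatSquareFunction s f x ^ (((d : ℝ) - 2 * s) / (2 * d)) := by
  obtain ⟨A, hA, hle⟩ := exists_heatExtension_le hs hsd hf hE
  have hG := Real.Gamma_pos_of_pos hs
  have has : s < (d : ℝ) / 4 + s / 2 := by linarith
  have hexp : ((d : ℝ) / 4 + s / 2 - s) / (2 * (d / 4 + s / 2) - s) = (d - 2 * s) / (2 * d) := by
    field_simp; ring
  refine ⟨(Real.Gamma s)⁻¹ * (1 / s + 1 + A / ((d : ℝ) / 4 + s / 2 - s)), fun x => ?_⟩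
  have hsub := lintegral_rpow_mul_heatExtension hs hsd one_pos hf x
  simp only [one_mul, Real.one_rpow] at hsub
  have h := lintegral_rpow_mul_le_rpow (q := fun t => heatExtension f t x) (by fun_prop) hs has hA
    fun t ht => hle t ht x
  rw [hsub, hexp] at h
  calc lrieszPotential (2 * s) f x
      = ENNReal.ofReal (Real.Gamma s)⁻¹ *
          (ENNReal.ofReal (Real.Gamma s) * lrieszPotential (2 * s) f x) := by
        rw [← mul_assoc, ← ENNReal.ofReal_mul (by positivity), inv_mul_cancel₀ hG.ne',
          ENNReal.ofReal_one, one_mul]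
    _ ≤ _ := by
        rw [ENNReal.ofReal_mul (by positivity), mul_assoc]
        exact mul_le_mul_right h _

theorem lintegral_lrieszPotential_rpow_lt_top (hs : 0 < s) (hsd : s < (d : ℝ) / 2)
    (hf : Measurable f) (hE : lrieszEnergy (2 * s) f ≠ ⊤) :
    ∫⁻ x, lrieszPotential (2 * s) f x ^ (2 * d / (d - 2 * s)) < ⊤ := by
  obtain ⟨C, hC⟩ := exists_lrieszPotential_le hs hsd hf hE
  have hd : 0 < (d : ℝ) := by linarith
  have hk : 0 < (d : ℝ) - 2 * s := by linarith
  have hp : 0 ≤ 2 * (d : ℝ) / (d - 2 * s) := by positivity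
  calc ∫⁻ x, lrieszPotential (2 * s) f x ^ (2 * d / (d - 2 * s))
      ≤ ∫⁻ x, ENNReal.ofReal C ^ (2 * d / (d - 2 * s)) * heatSquareFunction s f x := by
        refine lintegral_mono fun x => (ENNReal.rpow_le_rpow (hC x) hp).trans_eq ?_
        rw [ENNReal.mul_rpow_of_nonneg _ _ hp, ← ENNReal.rpow_mul, div_mul_div_cancel₀' hk.ne',
          div_self (by positivity), ENNReal.rpow_one]
    _ = ENNReal.ofReal C ^ (2 * d / (d - 2 * s)) *
          (ENNReal.ofReal (2 ^ (-s) * Real.Gamma s) * lrieszEnergy (2 * s) f) := by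
        rw [lintegral_const_mul _ (measurable_heatSquareFunction s hf),
          lintegral_heatSquareFunction hs hsd hf]
    _ < ⊤ := ENNReal.mul_lt_top (ENNReal.rpow_lt_top_of_nonneg hp ENNReal.ofReal_ne_top)
        (ENNReal.mul_lt_top ENNReal.ofReal_lt_top hE.lt_top)

/-! ### Superpositions of nonnegative kernels -/

section Superposition

variable {X Y E : Type*} [MeasurableSpace X] [MeasurableSpace Y] [NormedAddCommGroup E]
  [NormedSpace ℝ E] {μ : Measure X} {ν : Measure Y} {K : X → Y → ℝ} {w : Y → ℝ} {F : Y → E}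

/-- For `ν`-almost every `y`, the value `w y` is the absolutely convergent integral `∫ K x y dμ(x)`
of a nonnegative kernel `K`. This is how Riesz kernels are written as superpositions of Gaussians,
both in position and in frequency. -/
structure IsSuperposition (μ : Measure X) (ν : Measure Y) (K : X → Y → ℝ) (w : Y → ℝ) : Prop where
  measurable : Measurable (Function.uncurry K)
  nonneg : ∀ᵐ x ∂μ, ∀ y, 0 ≤ K x y
  integrable : ∀ᵐ y ∂ν, Integrable (K · y) μ
  integral_eq : ∀ᵐ y ∂ν, ∫ x, K x y ∂μ = w y

namespace IsSuperposition

theorem integral_norm_smul (h : IsSuperposition μ ν K w) (F : Y → E) :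
    (fun y => ∫ x, ‖K x y • F y‖ ∂μ) =ᵐ[ν] fun y => ‖w y • F y‖ := by
  filter_upwards [h.integral_eq] with y hy
  have hnn : 0 ≤ᵐ[μ] (K · y) := h.nonneg.mono fun x hx => hx y
  have hw : 0 ≤ w y := hy ▸ integral_nonneg_of_ae hnn
  rw [norm_smul, Real.norm_of_nonneg hw, ← hy, ← integral_mul_const]
  refine integral_congr_ae (hnn.mono fun x hx => ?_)
  simp only [norm_smul, Real.norm_of_nonneg hx]

theorem aestronglyMeasurable_prod_smul [SFinite μ] [SFinite ν]
    (h : IsSuperposition μ ν K w) (hF : AEStronglyMeasurable F ν) :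
    AEStronglyMeasurable (fun z : X × Y => K z.1 z.2 • F z.2) (μ.prod ν) :=
  h.measurable.aestronglyMeasurable.smul hF.comp_snd

theorem integrable_prod_smul_iff [SFinite μ] [SFinite ν] (h : IsSuperposition μ ν K w)
    (hF : AEStronglyMeasurable F ν) :
    Integrable (fun z : X × Y => K z.1 z.2 • F z.2) (μ.prod ν) ↔
      Integrable (fun y => w y • F y) ν := by
  have hw : AEStronglyMeasurable w ν :=
    (h.measurable.stronglyMeasurable.integral_prod_left'
      (μ := μ)).aestronglyMeasurable.congr h.integral_eq
  rw [integrable_prod_iff' (h.aestronglyMeasurable_prod_smul hF),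
    integrable_congr (h.integral_norm_smul F), and_iff_right]
  · exact integrable_norm_iff (hw.smul hF)
  · exact h.integrable.mono fun y hy => hy.smul_const (F y)

theorem integral_integral_smul [CompleteSpace E] [SFinite μ] [SFinite ν]
    (h : IsSuperposition μ ν K w) (hF : AEStronglyMeasurable F ν)
    (hi : Integrable (fun y => w y • F y) ν) :
    ∫ x, ∫ y, K x y • F y ∂ν ∂μ = ∫ y, w y • F y ∂ν := by
  rw [integral_integral_swap ((h.integrable_prod_smul_iff hF).2 hi)]
  refine integral_congr_ae (h.integral_eq.mono fun y hy => ?_)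
  exact (integral_smul_const _ _).trans (by rw [hy])

end IsSuperposition

end Superposition

/-! ### Parseval's identity for the Riesz kernel -/

/-- The symbol `|ξ|^a` of the fractional power `(-Δ)^(a/2)` of the Laplacian, in the frequency
variable of the Fourier transform of Mathlib. -/
noncomputable def freqWeight (a : ℝ) (ξ : 𝔼 d) : ℝ :=
  (2 * Real.pi * ‖ξ‖) ^ a

theorem freqWeight_nonneg (a : ℝ) (ξ : 𝔼 d) : 0 ≤ freqWeight a ξ := by
  unfold freqWeight
  positivity

theorem freqWeight_sq (a : ℝ) (ξ : 𝔼 d) : freqWeight a ξ ^ 2 = freqWeight (2 * a) ξ := by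
  rw [freqWeight, freqWeight, ← Real.rpow_mul_natCast (by positivity), mul_comm a, Nat.cast_ofNat]

@[fun_prop]
theorem measurable_freqWeight (a : ℝ) : Measurable (freqWeight a : 𝔼 d → ℝ) := by
  unfold freqWeight
  fun_prop

theorem ae_ne_zero [NeZero d] : ∀ᵐ ξ : 𝔼 d, ξ ≠ 0 := by
  simp [ae_iff]

theorem ae_fst_ne_snd [NeZero d] : ∀ᵐ p : 𝔼 d × 𝔼 d, p.1 ≠ p.2 := by
  have hm : MeasurableSet {p : 𝔼 d × 𝔼 d | p.1 ≠ p.2} :=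
    (measurableSet_eq_fun measurable_fst measurable_snd).compl
  refine (Measure.ae_prod_iff_ae_ae hm).2 (Eventually.of_forall fun x => ?_)
  have hne : ∀ᵐ y : 𝔼 d, y ≠ x := by simp [ae_iff]
  exact hne.mono fun y hy => hy.symm

theorem isSuperposition_rieszKernel (hs : 0 < s) (hsd : s < (d : ℝ) / 2) :
    IsSuperposition (volume.restrict (Ioi (0 : ℝ))) volume
      (fun t (p : 𝔼 d × 𝔼 d) => t ^ (s - 1) / Real.Gamma s * heatKernel d t (p.1 - p.2))
      fun p => rieszKernel d (2 * s) (p.1 - p.2) := by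
  have := neZero_of_lt_half hs hsd
  have hΓ : 0 < Real.Gamma s := Real.Gamma_pos_of_pos hs
  have hK : ∀ (x : 𝔼 d) (t : ℝ), t ^ (s - 1) / Real.Gamma s * heatKernel d t x =
      (Real.Gamma s)⁻¹ * (t ^ (s - 1) * heatKernel d (1 * t) x) := fun x t => by
    rw [one_mul]; ring
  refine ⟨by unfold Function.uncurry; fun_prop, ?_, ?_, ?_⟩
  · refine ae_restrict_of_forall_mem measurableSet_Ioi fun t (ht : 0 < t) p => ?_
    exact mul_nonneg (by positivity) (heatKernel_nonneg ht.le _)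
  · filter_upwards [ae_fst_ne_snd] with p hp
    simp only [hK]
    exact (integrableOn_rpow_mul_heatKernel hsd one_pos (sub_ne_zero.2 hp)).const_mul _
  · filter_upwards [ae_fst_ne_snd] with p hp
    simp only [hK]
    rw [integral_const_mul, integral_rpow_mul_heatKernel hs hsd one_pos (sub_ne_zero.2 hp),
      Real.one_rpow, one_mul, inv_mul_cancel_left₀ hΓ.ne']

theorem isSuperposition_freqWeight [NeZero d] (hs : 0 < s) :
    IsSuperposition (volume.restrict (Ioi (0 : ℝ))) volume
      (fun t (ξ : 𝔼 d) =>
        t ^ (s - 1) / Real.Gamma s * Real.exp (-(4 * Real.pi ^ 2 * t) * ‖ξ‖ ^ 2))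
      (freqWeight (-(2 * s))) := by
  have hΓ : 0 < Real.Gamma s := Real.Gamma_pos_of_pos hs
  have hK : ∀ (ξ : 𝔼 d) (t : ℝ),
      t ^ (s - 1) / Real.Gamma s * Real.exp (-(4 * Real.pi ^ 2 * t) * ‖ξ‖ ^ 2) =
      (Real.Gamma s)⁻¹ * (t ^ (s - 1) * Real.exp (-((2 * Real.pi * ‖ξ‖) ^ 2 * t))) := fun ξ t => by
    rw [show -(4 * Real.pi ^ 2 * t) * ‖ξ‖ ^ 2 = -((2 * Real.pi * ‖ξ‖) ^ 2 * t) by ring]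
    ring
  refine ⟨by unfold Function.uncurry; fun_prop, ?_, ?_, ?_⟩
  · refine ae_restrict_of_forall_mem measurableSet_Ioi fun t (ht : 0 < t) ξ => ?_
    positivity
  · filter_upwards [ae_ne_zero] with ξ hξ
    have := norm_pos_iff.2 hξ
    simp only [hK]
    refine Integrable.const_mul ?_ _
    simpa [IntegrableOn] using integrableOn_rpow_mul_exp_neg_mul_rpow (s := s - 1) (p := 1)
      (b := (2 * Real.pi * ‖ξ‖) ^ 2) (by linarith) one_pos (by positivity)
  · filter_upwards [ae_ne_zero] with ξ hξ
    have := norm_pos_iff.2 hξ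
    simp only [hK]
    rw [integral_const_mul, Real.integral_rpow_mul_exp_neg_mul_Ioi hs (by positivity),
      mul_comm (_ ^ s), inv_mul_cancel_left₀ hΓ.ne', one_div, ← Real.rpow_neg_eq_inv_rpow,
      ← Real.rpow_natCast, ← Real.rpow_mul (by positivity), freqWeight]
    congr 1
    push_cast
    ring

theorem heatKernel_eq_integral {t : ℝ} (ht : 0 < t) (z : 𝔼 d) :
    (heatKernel d t z : ℂ) = ∫ ξ : 𝔼 d,
      Complex.exp (↑(-2 * Real.pi * inner ℝ ξ z) * Complex.I) *
        (Real.exp (-(4 * Real.pi ^ 2 * t) * ‖ξ‖ ^ 2) : ℂ) := by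
  have hb : 0 < ((4 * Real.pi ^ 2 * t : ℝ) : ℂ).re := by
    rw [Complex.ofReal_re]; positivity
  have h := fourier_gaussian_innerProductSpace hb z
  simp only [Real.fourier_eq', smul_eq_mul, finrank_euclideanSpace_fin] at h
  have hexp : ∀ ξ : 𝔼 d, (Real.exp (-(4 * Real.pi ^ 2 * t) * ‖ξ‖ ^ 2) : ℂ) =
      Complex.exp (-((4 * Real.pi ^ 2 * t : ℝ) : ℂ) * (‖ξ‖ : ℂ) ^ 2) := fun ξ => by
    push_cast; rfl
  have hpow : ((Real.pi : ℂ) / ((4 * Real.pi ^ 2 * t : ℝ) : ℂ)) ^ ((d : ℂ) / 2) =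
      (((4 * Real.pi * t) ^ (-(d : ℝ) / 2) : ℝ) : ℂ) := by
    rw [← Complex.ofReal_div, show (d : ℂ) / 2 = ((d / 2 : ℝ) : ℂ) by push_cast; rfl,
      ← Complex.ofReal_cpow (by positivity), neg_div, Real.rpow_neg (by positivity),
      ← Real.inv_rpow (by positivity)]
    congr 2
    field_simp
  simp_rw [hexp]
  rw [h, heatKernel, hpow, Complex.ofReal_mul, Complex.ofReal_exp]
  congr 2
  have : (t : ℂ) ≠ 0 := by exact_mod_cast ht.ne'
  have : (Real.pi : ℂ) ≠ 0 := by exact_mod_cast Real.pi_ne_zero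
  push_cast
  field_simp

theorem continuous_fourier_of_integrable {f : 𝔼 d → ℂ} (hf : Integrable f) : Continuous (𝓕 f) :=
  VectorFourier.fourierIntegral_continuous Real.continuous_fourierChar
    (by exact continuous_inner) hf

theorem norm_fourier_le (f : 𝔼 d → ℂ) (ξ : 𝔼 d) : ‖𝓕 f ξ‖ ≤ ∫ x, ‖f x‖ :=
  VectorFourier.norm_fourierIntegral_le_integral_norm _ _ _ _ _

section Parseval

variable {f k : 𝔼 d → ℂ}

theorem integral_exp_sub_mul_eq_fourier_mul_fourier (f k : 𝔼 d → ℂ) (ξ : 𝔼 d) :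
    ∫ p : 𝔼 d × 𝔼 d,
      Complex.exp (↑(-2 * Real.pi * inner ℝ ξ (p.1 - p.2)) * Complex.I) * (f p.1 * k p.2) =
    𝓕 f ξ * 𝓕 k (-ξ) := by
  rw [Real.fourier_eq', Real.fourier_eq', ← integral_prod_mul]
  congr 1 with p
  have hexp : Complex.exp (↑(-2 * Real.pi * inner ℝ ξ (p.1 - p.2)) * Complex.I) =
      Complex.exp (↑(-2 * Real.pi * inner ℝ p.1 ξ) * Complex.I) *
      Complex.exp (↑(-2 * Real.pi * inner ℝ p.2 (-ξ)) * Complex.I) := by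
    rw [← Complex.exp_add, inner_sub_right, inner_neg_right, real_inner_comm p.1,
      real_inner_comm p.2]
    push_cast
    ring_nf
  rw [hexp, smul_eq_mul, smul_eq_mul]
  ring

theorem integral_heatKernel_smul (hf : Integrable f) (hk : Integrable k) {t : ℝ} (ht : 0 < t) :
    ∫ p : 𝔼 d × 𝔼 d, heatKernel d t (p.1 - p.2) • (f p.1 * k p.2) =
    ∫ ξ, Real.exp (-(4 * Real.pi ^ 2 * t) * ‖ξ‖ ^ 2) • (𝓕 f ξ * 𝓕 k (-ξ)) := by
  have hb : 0 < 4 * Real.pi ^ 2 * t := by positivity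
  have hgauss : Integrable fun ξ : 𝔼 d =>
      (Real.exp (-(4 * Real.pi ^ 2 * t) * ‖ξ‖ ^ 2) : ℂ) :=
    (integrable_exp_neg_mul_sq_norm hb).ofReal
  have hint : Integrable (Function.uncurry fun (p : 𝔼 d × 𝔼 d) (ξ : 𝔼 d) =>
      Complex.exp (↑(-2 * Real.pi * inner ℝ ξ (p.1 - p.2)) * Complex.I) *
        ((f p.1 * k p.2) * (Real.exp (-(4 * Real.pi ^ 2 * t) * ‖ξ‖ ^ 2) : ℂ)))
      ((volume.prod volume).prod volume) := by
    refine ((hf.mul_prod hk).mul_prod hgauss).bdd_mul (c := 1)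
      (Continuous.aestronglyMeasurable (by fun_prop)) (Eventually.of_forall fun p => ?_)
    rw [Complex.norm_exp_ofReal_mul_I]
  calc
    _ = ∫ p : 𝔼 d × 𝔼 d, ∫ ξ : 𝔼 d,
          Complex.exp (↑(-2 * Real.pi * inner ℝ ξ (p.1 - p.2)) * Complex.I) *
            ((f p.1 * k p.2) * (Real.exp (-(4 * Real.pi ^ 2 * t) * ‖ξ‖ ^ 2) : ℂ)) := by
      congr 1 with p
      rw [Complex.real_smul, heatKernel_eq_integral ht, ← integral_mul_const]
      congr 1 with ξ
      ring
    _ = ∫ ξ : 𝔼 d, ∫ p : 𝔼 d × 𝔼 d,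
          Complex.exp (↑(-2 * Real.pi * inner ℝ ξ (p.1 - p.2)) * Complex.I) *
            ((f p.1 * k p.2) * (Real.exp (-(4 * Real.pi ^ 2 * t) * ‖ξ‖ ^ 2) : ℂ)) :=
      integral_integral_swap hint
    _ = _ := by
      congr 1 with ξ
      rw [Complex.real_smul, ← integral_exp_sub_mul_eq_fourier_mul_fourier,
        ← integral_const_mul]
      congr 1 with p
      ring

theorem integral_rieszKernel_smul (hs : 0 < s) (hsd : s < (d : ℝ) / 2)
    (hf : Integrable f) (hk : Integrable k)
    (hI : Integrable fun p : 𝔼 d × 𝔼 d => rieszKernel d (2 * s) (p.1 - p.2) • (f p.1 * k p.2))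
    (hW : Integrable fun ξ => freqWeight (-(2 * s)) ξ • (𝓕 f ξ * 𝓕 k (-ξ))) :
    ∫ p : 𝔼 d × 𝔼 d, rieszKernel d (2 * s) (p.1 - p.2) • (f p.1 * k p.2) =
    ∫ ξ, freqWeight (-(2 * s)) ξ • (𝓕 f ξ * 𝓕 k (-ξ)) := by
  have := neZero_of_lt_half hs hsd
  have hF : Continuous fun ξ => 𝓕 f ξ * 𝓕 k (-ξ) :=
    (continuous_fourier_of_integrable hf).mul
      ((continuous_fourier_of_integrable hk).comp continuous_neg)
  rw [← (isSuperposition_rieszKernel hs hsd).integral_integral_smul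
      (hf.mul_prod hk).aestronglyMeasurable hI,
    ← (isSuperposition_freqWeight hs).integral_integral_smul hF.aestronglyMeasurable hW]
  refine setIntegral_congr_fun measurableSet_Ioi fun t ht => ?_
  simp only [mul_smul, integral_smul, integral_heatKernel_smul hf hk ht]

end Parseval

theorem fourier_conj (f : 𝔼 d → ℂ) (ξ : 𝔼 d) :
    𝓕 (fun x => conj (f x)) ξ = conj (𝓕 f (-ξ)) := by
  rw [Real.fourier_eq', Real.fourier_eq', ← integral_conj]
  congr 1 with x
  simp only [smul_eq_mul, map_mul, ← Complex.exp_conj, Complex.conj_ofReal, Complex.conj_I,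
    inner_neg_right]
  congr 2
  push_cast
  ring

theorem fourier_ofReal_neg (f : 𝔼 d → ℝ) (ξ : 𝔼 d) :
    𝓕 (fun x => (f x : ℂ)) (-ξ) = conj (𝓕 (fun x => (f x : ℂ)) ξ) := by
  simpa using fourier_conj (fun x => (f x : ℂ)) (-ξ)

theorem integral_heatKernel_smul_self {f : 𝔼 d → ℝ} (hf : Integrable f) {t : ℝ} (ht : 0 < t) :
    ∫ p : 𝔼 d × 𝔼 d, heatKernel d t (p.1 - p.2) • (f p.1 * f p.2) =
    ∫ ξ, Real.exp (-(4 * Real.pi ^ 2 * t) * ‖ξ‖ ^ 2) • ‖𝓕 (fun x => (f x : ℂ)) ξ‖ ^ 2 := by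
  have h := integral_heatKernel_smul (hf.ofReal (𝕜 := ℂ)) (hf.ofReal (𝕜 := ℂ)) ht
  simp only [fourier_ofReal_neg, Complex.mul_conj, Complex.normSq_eq_norm_sq, Complex.real_smul,
    ← Complex.ofReal_mul, integral_complex_ofReal, RCLike.ofReal_eq_complex_ofReal] at h
  exact_mod_cast h

theorem integrable_freqWeight_smul_norm_fourier_sq (hs : 0 < s) (hsd : s < (d : ℝ) / 2)
    {f : 𝔼 d → ℝ} (hf : Integrable f)
    (hI : Integrable fun p : 𝔼 d × 𝔼 d => rieszKernel d (2 * s) (p.1 - p.2) • (f p.1 * f p.2)) :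
    Integrable fun ξ => freqWeight (-(2 * s)) ξ • ‖𝓕 (fun x => (f x : ℂ)) ξ‖ ^ 2 := by
  have := neZero_of_lt_half hs hsd
  have hF : AEStronglyMeasurable (fun ξ => ‖𝓕 (fun x => (f x : ℂ)) ξ‖ ^ 2) volume :=
    ((continuous_fourier_of_integrable hf.ofReal).norm.pow 2).aestronglyMeasurable
  have hsup := isSuperposition_freqWeight (d := d) hs
  rw [← hsup.integrable_prod_smul_iff hF,
    integrable_prod_iff (hsup.aestronglyMeasurable_prod_smul hF)]
  constructor
  · refine ae_restrict_of_forall_mem measurableSet_Ioi fun t (ht : 0 < t) => ?_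
    refine Integrable.mul_bdd (c := (∫ x, ‖(f x : ℂ)‖) ^ 2)
      ((integrable_exp_neg_mul_sq_norm (b := 4 * Real.pi ^ 2 * t) (by positivity)).const_mul
        (t ^ (s - 1) / Real.Gamma s)) hF
      (Eventually.of_forall fun ξ => ?_)
    rw [norm_pow, norm_norm]
    gcongr
    exact norm_fourier_le _ ξ
  · have hheat := ((isSuperposition_rieszKernel hs hsd).integrable_prod_smul_iff
      (hf.mul_prod hf).aestronglyMeasurable).2 hI
    refine IntegrableOn.congr_fun hheat.integral_prod_left (fun t (ht : 0 < t) => ?_)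
      measurableSet_Ioi
    have : 0 < Real.Gamma s := Real.Gamma_pos_of_pos hs
    simp only [mul_smul, integral_smul, integral_heatKernel_smul_self hf ht]
    rw [← integral_smul]
    congr 1 with ξ
    exact (Real.norm_of_nonneg (by positivity)).symm

theorem integral_rieszKernel_smul_self (hs : 0 < s) (hsd : s < (d : ℝ) / 2)
    {f : 𝔼 d → ℝ} (hf : Integrable f)
    (hI : Integrable fun p : 𝔼 d × 𝔼 d => rieszKernel d (2 * s) (p.1 - p.2) • (f p.1 * f p.2)) :
    ∫ p : 𝔼 d × 𝔼 d, rieszKernel d (2 * s) (p.1 - p.2) • (f p.1 * f p.2) =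
    ∫ ξ, freqWeight (-(2 * s)) ξ • ‖𝓕 (fun x => (f x : ℂ)) ξ‖ ^ 2 := by
  have := neZero_of_lt_half hs hsd
  have hF : Continuous fun ξ => ‖𝓕 (fun x => (f x : ℂ)) ξ‖ ^ 2 :=
    (continuous_fourier_of_integrable hf.ofReal).norm.pow 2
  rw [← (isSuperposition_rieszKernel hs hsd).integral_integral_smul
      (hf.mul_prod hf).aestronglyMeasurable hI,
    ← (isSuperposition_freqWeight hs).integral_integral_smul hF.aestronglyMeasurable
      (integrable_freqWeight_smul_norm_fourier_sq hs hsd hf hI)]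
  refine setIntegral_congr_fun measurableSet_Ioi fun t ht => ?_
  simp only [mul_smul, integral_smul, integral_heatKernel_smul_self hf ht]

/-! ### Weighted Schwartz functions and test functions -/

theorem integrableOn_ball_freqWeight [NeZero d] {a : ℝ} (ha : -(d : ℝ) < a) :
    IntegrableOn (freqWeight a : 𝔼 d → ℝ) (Metric.ball 0 1) := by
  refine (integrableOn_fun_norm_addHaar (E := 𝔼 d) volume
    (f := fun r : ℝ => (2 * Real.pi * r) ^ a) (r := 1)).2 ?_
  rw [finrank_euclideanSpace_fin]
  have hd : 1 ≤ d := Nat.one_le_iff_ne_zero.2 (NeZero.ne d)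
  have hpolar : ∀ r ∈ Ioo (0 : ℝ) 1, (2 * Real.pi) ^ a * r ^ ((d : ℝ) - 1 + a) =
      r ^ (d - 1) • (2 * Real.pi * r) ^ a := by
    intro r hr
    rw [smul_eq_mul, Real.mul_rpow (by positivity) hr.1.le, Real.rpow_add hr.1,
      ← Real.rpow_natCast, Nat.cast_sub hd]
    push_cast
    ring
  refine IntegrableOn.congr_fun (Integrable.const_mul ?_ _) hpolar measurableSet_Ioo
  exact (intervalIntegrable_iff_integrableOn_Ioo_of_le zero_le_one).1 <|
    intervalIntegral.intervalIntegrable_rpow' (by linarith)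

theorem freqWeight_le_pow_ceil (a : ℝ) {ξ : 𝔼 d} (hξ : 1 ≤ ‖ξ‖) :
    freqWeight a ξ ≤ (2 * Real.pi) ^ ⌈|a|⌉₊ * ‖ξ‖ ^ ⌈|a|⌉₊ := by
  rw [← mul_pow, ← Real.rpow_natCast]
  exact Real.rpow_le_rpow_of_exponent_le (by nlinarith [Real.pi_gt_three])
    ((le_abs_self a).trans (Nat.le_ceil _))

theorem integrable_freqWeight_smul_schwartz [NeZero d] {a : ℝ} (ha : -(d : ℝ) < a)
    (φ : 𝓢(𝔼 d, ℂ)) : Integrable fun ξ => freqWeight a ξ • φ ξ := by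
  set C := SchwartzMap.seminorm ℝ 0 0 φ
  have hball : Integrable ((Metric.ball (0 : 𝔼 d) 1).indicator fun ξ => freqWeight a ξ * C) :=
    (integrable_indicator_iff measurableSet_ball).2 ((integrableOn_ball_freqWeight ha).mul_const C)
  have hdecay := (φ.integrable_pow_mul volume ⌈|a|⌉₊).const_mul ((2 * Real.pi) ^ ⌈|a|⌉₊)
  refine (hball.add hdecay).mono' (by fun_prop) (Eventually.of_forall fun ξ => ?_)
  rw [norm_smul, Real.norm_of_nonneg (freqWeight_nonneg a ξ), Pi.add_apply]
  by_cases hξ : ξ ∈ Metric.ball (0 : 𝔼 d) 1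
  · rw [indicator_of_mem hξ]
    have hφ : freqWeight a ξ * ‖φ ξ‖ ≤ freqWeight a ξ * C :=
      mul_le_mul_of_nonneg_left (φ.norm_le_seminorm ℝ ξ) (freqWeight_nonneg a ξ)
    exact hφ.trans (le_add_of_nonneg_right (by positivity))
  · rw [indicator_of_notMem hξ, zero_add, ← mul_assoc]
    exact mul_le_mul_of_nonneg_right (freqWeight_le_pow_ceil a (by simpa using hξ)) (norm_nonneg _)

theorem norm_freqWeight_smul_sq (a : ℝ) (ξ : 𝔼 d) (z : ℂ) :
    ‖freqWeight a ξ • z‖ ^ 2 = freqWeight (2 * a) ξ * ‖z‖ ^ 2 := by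
  rw [norm_smul, mul_pow, Real.norm_eq_abs, sq_abs, freqWeight_sq]

theorem memLp_two_freqWeight_smul_iff {a : ℝ} {g : 𝔼 d → ℂ} (hg : AEStronglyMeasurable g) :
    MemLp (fun ξ => freqWeight a ξ • g ξ) 2 ↔
      Integrable fun ξ => freqWeight (2 * a) ξ * ‖g ξ‖ ^ 2 := by
  rw [memLp_two_iff_integrable_sq_norm (by fun_prop)]
  simp_rw [norm_freqWeight_smul_sq]

theorem memLp_two_freqWeight_smul_schwartz [NeZero d] {a : ℝ} (ha : -(d : ℝ) / 2 < a)
    (φ : 𝓢(𝔼 d, ℂ)) : MemLp (fun ξ => freqWeight a ξ • φ ξ) 2 := by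
  rw [memLp_two_freqWeight_smul_iff φ.continuous.aestronglyMeasurable]
  refine ((integrable_freqWeight_smul_schwartz (a := 2 * a) (by linarith) φ).norm.mul_bdd
    (c := SchwartzMap.seminorm ℝ 0 0 φ) φ.continuous.norm.aestronglyMeasurable
    (Eventually.of_forall fun ξ => ?_)).congr (Eventually.of_forall fun ξ => ?_)
  · rw [norm_norm]
    exact φ.norm_le_seminorm ℝ ξ
  · simp only [norm_smul, Real.norm_of_nonneg (freqWeight_nonneg _ ξ)]
    ring

theorem freqWeight_pos (a : ℝ) {ξ : 𝔼 d} (hξ : ξ ≠ 0) : 0 < freqWeight a ξ := by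
  have := norm_pos_iff.2 hξ
  unfold freqWeight
  positivity

theorem freqWeight_neg_mul_freqWeight (a : ℝ) {ξ : 𝔼 d} (hξ : ξ ≠ 0) :
    freqWeight (-a) ξ * freqWeight a ξ = 1 := by
  have := norm_pos_iff.2 hξ
  rw [freqWeight, freqWeight, ← Real.rpow_add (by positivity), neg_add_cancel, Real.rpow_zero]

theorem integrable_mul_schwartz {f : 𝔼 d → ℂ} (hf : Integrable f) (φ : 𝓢(𝔼 d, ℂ)) :
    Integrable fun x => f x * φ x :=
  hf.mul_bdd φ.continuous.aestronglyMeasurable (Eventually.of_forall (φ.norm_le_seminorm ℝ))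

/-- A real test function as a complex Schwartz function. -/
noncomputable def testToSchwartz {φ : 𝔼 d → ℝ} (hφ : ContDiff ℝ ∞ φ) (hc : HasCompactSupport φ) :
    𝓢(𝔼 d, ℂ) :=
  (hc.comp_left (g := fun r : ℝ => (r : ℂ)) rfl).toSchwartzMap
    (Complex.ofRealCLM.contDiff.comp hφ)

@[simp]
theorem testToSchwartz_apply {φ : 𝔼 d → ℝ} (hφ : ContDiff ℝ ∞ φ) (hc : HasCompactSupport φ)
    (x : 𝔼 d) : testToSchwartz hφ hc x = (φ x : ℂ) := rfl

theorem integral_fourier_mul_eq_of_integrable {f g : 𝔼 d → ℂ} (hf : Integrable f)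
    (hg : Integrable g) : ∫ ξ, 𝓕 f ξ * g ξ = ∫ x, f x * 𝓕 g x := by
  simpa using! VectorFourier.integral_fourierIntegral_smul_eq_flip (L := innerₗ _)
    Real.continuous_fourierChar continuous_inner hf hg

theorem ae_eq_zero_of_fourier_eq_zero {G : 𝔼 d → ℂ} (hG : Integrable G) (h : ∀ x, 𝓕 G x = 0) :
    G =ᵐ[volume] 0 := by
  refine ae_eq_zero_of_integral_contDiff_smul_eq_zero hG.locallyIntegrable fun φ hφ hc => ?_
  set ψ : 𝓢(𝔼 d, ℂ) := 𝓕⁻ (testToSchwartz hφ hc)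
  have hψ : 𝓕 (ψ : 𝔼 d → ℂ) = testToSchwartz hφ hc := by
    rw [← SchwartzMap.fourier_coe, FourierTransform.fourier_fourierInv_eq]
  have hswap := integral_fourier_mul_eq_of_integrable ψ.integrable hG
  simp only [hψ, h, mul_zero, integral_zero] at hswap
  exact hswap

theorem locallyIntegrable_conj_comp_neg {g : 𝔼 d → ℂ} (hg : LocallyIntegrable g) :
    LocallyIntegrable fun ξ => conj (g (-ξ)) := by
  have hneg : LocallyIntegrable (g ∘ Homeomorph.neg (𝔼 d)) := by
    rw [← locallyIntegrable_map_homeomorph]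
    exact (Measure.map_neg_eq_self (volume : Measure (𝔼 d))).symm ▸ hg
  exact hneg.mono (Complex.continuous_conj.comp_aestronglyMeasurable hneg.aestronglyMeasurable)
    (Eventually.of_forall fun ξ => (RCLike.norm_conj _).le)

theorem integrable_conj {X : Type*} [MeasurableSpace X] {μ : Measure X} {f : X → ℂ}
    (hf : Integrable f μ) : Integrable (fun x => conj (f x)) μ :=
  Complex.conjLIE.integrable_comp_iff.2 hf

namespace IsDistribFourier

theorem conj_comp_neg {u : 𝔼 d → ℝ} {g : 𝔼 d → ℂ} (hg : IsDistribFourier u g) :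
    IsDistribFourier u fun ξ => conj (g (-ξ)) := by
  refine ⟨locallyIntegrable_conj_comp_neg hg.1, fun φ => ?_⟩
  set ψ : 𝓢(𝔼 d, ℂ) := (SchwartzMap.compCLMOfContinuousLinearEquiv ℝ
    (ContinuousLinearEquiv.neg ℝ) φ).postcompCLM Complex.conjCLE.toContinuousLinearMap
  have hψ : ∀ ξ, g ξ * ψ ξ = conj (conj (g ξ) * φ (-ξ)) := fun ξ => by
    simp [ψ]
  have hψF : ∀ x, (𝓕 ψ) x = conj ((𝓕 φ) x) := fun x => by
    rw [SchwartzMap.fourier_coe, SchwartzMap.fourier_coe]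
    have hcoe : (ψ : 𝔼 d → ℂ) = fun x => conj ((φ ∘ LinearIsometryEquiv.neg ℝ) x) := rfl
    rw [hcoe, fourier_conj, Real.fourier_comp_linearIsometry, LinearIsometryEquiv.coe_neg]
    simp only [neg_neg]
  obtain ⟨_, hiψ, heq⟩ := hg.2 ψ
  refine ⟨(hg.2 φ).1, ?_, ?_⟩
  · simpa [hψ] using integrable_conj hiψ.comp_neg
  · calc
      _ = ∫ ξ, conj (g ξ) * φ (-ξ) := by
        rw [← integral_neg_eq_self]
        simp only [neg_neg]
      _ = conj (∫ x, (u x : ℂ) * (𝓕 ψ) x) := by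
        rw [← heq, ← integral_conj]
        simp only [hψ, Complex.conj_conj]
      _ = _ := by
        rw [← integral_conj]
        simp only [hψF, map_mul, Complex.conj_ofReal, Complex.conj_conj]

theorem ae_neg {u : 𝔼 d → ℝ} {g : 𝔼 d → ℂ} (hg : IsDistribFourier u g) :
    ∀ᵐ ξ, g (-ξ) = conj (g ξ) := by
  filter_upwards [hg.unique hg.conj_comp_neg] with ξ hξ
  rw [hξ, Complex.conj_conj]

theorem ae_eq_zero {u : 𝔼 d → ℝ} {g : 𝔼 d → ℂ} (hg : IsDistribFourier u g)
    (hu : LocallyIntegrable u) (hg0 : g =ᵐ[volume] 0) : u =ᵐ[volume] 0 := by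
  refine ae_eq_zero_of_integral_contDiff_smul_eq_zero hu fun φ hφ hc => ?_
  have hpair := (hg.2 (𝓕⁻ (testToSchwartz hφ hc))).2.2
  have hzero : ∫ ξ, g ξ * (𝓕⁻ (testToSchwartz hφ hc)) ξ = 0 :=
    integral_eq_zero_of_ae (hg0.mono fun ξ hξ => by simp [hξ])
  simp only [hzero, FourierTransform.fourier_fourierInv_eq, testToSchwartz_apply,
    ← Complex.ofReal_mul, integral_complex_ofReal] at hpair
  simpa [mul_comm] using (Complex.ofReal_eq_zero.1 hpair.symm)

end IsDistribFourier

theorem isDistribFourier_test {φ : 𝔼 d → ℝ} (hφ : ContDiff ℝ ∞ φ) (hc : HasCompactSupport φ) :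
    IsDistribFourier φ (𝓕 (testToSchwartz hφ hc) : 𝓢(𝔼 d, ℂ)) :=
  ⟨(𝓕 (testToSchwartz hφ hc)).integrable.locallyIntegrable, fun ψ =>
    ⟨integrable_mul_schwartz (testToSchwartz hφ hc).integrable (𝓕 ψ),
      integrable_mul_schwartz (𝓕 (testToSchwartz hφ hc)).integrable ψ,
      SchwartzMap.integral_fourier_mul_eq (testToSchwartz hφ hc) ψ⟩⟩

theorem hasFiniteHomNorm_test [NeZero d] (hs : 0 < s) {φ : 𝔼 d → ℝ} (hφ : ContDiff ℝ ∞ φ)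
    (hc : HasCompactSupport φ) : HasFiniteHomNorm s φ := by
  have : 0 ≤ (d : ℝ) := Nat.cast_nonneg d
  exact ⟨_, isDistribFourier_test hφ hc, (memLp_two_freqWeight_smul_iff
    (𝓕 (testToSchwartz hφ hc)).continuous.aestronglyMeasurable).1
    (memLp_two_freqWeight_smul_schwartz (by linarith) _)⟩

namespace HomSobolev

/-- The element of `H̊ˢ(ℝᵈ)` represented by a function in `Lᵖ`, `p = 2d/(d - 2s)`, of finite
homogeneous norm. -/
noncomputable def ofMemLp {u : 𝔼 d → ℝ} (hu : MemLp u (ENNReal.ofReal (2 * d / (d - 2 * s))))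
    (h : HasFiniteHomNorm s u) : HomSobolev d s :=
  (⟨hu.toLp u, h.congr hu.coeFn_toLp.symm⟩ : homSobolevSubmodule d s)

theorem coeFn_ofMemLp {u : 𝔼 d → ℝ} (hu : MemLp u (ENNReal.ofReal (2 * d / (d - 2 * s))))
    (h : HasFiniteHomNorm s u) : ofMemLp hu h =ᵐ[volume] u :=
  hu.coeFn_toLp

theorem ext_ae {u v : HomSobolev d s} (h : u =ᵐ[volume] v) : u = v :=
  Subtype.ext (Lp.ext h)

theorem fourier_ae_eq {u : HomSobolev d s} {v : 𝔼 d → ℝ} {g : 𝔼 d → ℂ} (huv : u =ᵐ[volume] v)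
    (hg : IsDistribFourier v g) : u.fourier =ᵐ[volume] g :=
  u.isDistribFourier_fourier.unique (hg.congr huv.symm)

theorem exists_test [NeZero d] (hs : 0 < s) {φ : 𝔼 d → ℝ} (hφ : ContDiff ℝ ∞ φ)
    (hc : HasCompactSupport φ) : ∃ u : HomSobolev d s, u =ᵐ[volume] φ :=
  ⟨ofMemLp (hφ.continuous.memLp_of_hasCompactSupport hc) (hasFiniteHomNorm_test hs hφ hc),
    coeFn_ofMemLp _ _⟩

end HomSobolev

/-! ### Density of the test functions in `H̊ˢ(ℝᵈ)` -/

namespace HomSobolev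

theorem memLp_freqWeight_smul_fourier (u : HomSobolev d s) :
    MemLp (fun ξ => freqWeight s ξ • u.fourier ξ) 2 :=
  (memLp_two_freqWeight_smul_iff u.isDistribFourier_fourier.1.aestronglyMeasurable).2
    u.integrable_fourier

/-- The isometry `u ↦ |ξ|ˢ û` of `H̊ˢ(ℝᵈ)` into `L²(ℝᵈ)`. -/
noncomputable def toL2 (d : ℕ) (s : ℝ) :
    HomSobolev d s →ₗᵢ[ℝ] Lp (α := 𝔼 d) ℂ 2 volume where
  toFun u := u.memLp_freqWeight_smul_fourier.toLp
  map_add' u v := by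
    rw [← MemLp.toLp_add]
    exact MemLp.toLp_congr _ _ ((fourier_add u v).mono fun ξ hξ => by simp [hξ])
  map_smul' r u := by
    rw [RingHom.id_apply, ← MemLp.toLp_const_smul]
    exact MemLp.toLp_congr _ _ ((fourier_smul r u).mono fun ξ hξ => by
      simp only [hξ, Pi.smul_apply, smul_comm r])
  norm_map' u := by
    suffices h : ‖u.memLp_freqWeight_smul_fourier.toLp‖ ^ 2 = ‖u‖ ^ 2 from
      (pow_left_inj₀ (norm_nonneg _) (norm_nonneg _) two_ne_zero).1 h
    rw [norm_sq_eq, ← real_inner_self_eq_norm_sq, L2.inner_def]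
    refine integral_congr_ae ?_
    filter_upwards [u.memLp_freqWeight_smul_fourier.coeFn_toLp] with ξ hξ
    rw [hξ, real_inner_self_eq_norm_sq, norm_freqWeight_smul_sq, freqWeight]

theorem coeFn_toL2 (u : HomSobolev d s) :
    toL2 d s u =ᵐ[volume] fun ξ => freqWeight s ξ • u.fourier ξ :=
  u.memLp_freqWeight_smul_fourier.coeFn_toLp

theorem coeFn_toL2_of_ae_eq {u : HomSobolev d s} {v : 𝔼 d → ℝ} {g : 𝔼 d → ℂ}
    (huv : u =ᵐ[volume] v) (hg : IsDistribFourier v g) :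
    toL2 d s u =ᵐ[volume] fun ξ => freqWeight s ξ • g ξ := by
  filter_upwards [u.coeFn_toL2, fourier_ae_eq huv hg] with ξ hu hξ
  rw [hu, hξ]

theorem memLp_coeFn (u : HomSobolev d s) :
    MemLp u (ENNReal.ofReal (2 * d / (d - 2 * s))) := Lp.memLp u.toLp

theorem one_le_exponent (hs : 0 < s) (hsd : s < (d : ℝ) / 2) :
    1 ≤ ENNReal.ofReal (2 * d / (d - 2 * s)) := by
  rw [ENNReal.one_le_ofReal, le_div_iff₀ (by linarith)]
  linarith

theorem toL2_injective (hs : 0 < s) (hsd : s < (d : ℝ) / 2) :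
    Function.Injective (toL2 d s) := by
  have := neZero_of_lt_half hs hsd
  rw [injective_iff_map_eq_zero]
  intro u hu
  have hfourier : u.fourier =ᵐ[volume] 0 := by
    filter_upwards [u.coeFn_toL2, Lp.coeFn_zero ℂ 2 (volume : Measure (𝔼 d)), ae_ne_zero]
      with ξ hξu hξ0 hξ
    rw [hu, hξ0, Pi.zero_apply] at hξu
    exact (smul_eq_zero.1 hξu.symm).resolve_left (freqWeight_pos s hξ).ne'
  exact ext_ae <| (u.isDistribFourier_fourier.ae_eq_zero
    (u.memLp_coeFn.locallyIntegrable (one_le_exponent hs hsd)) hfourier).trans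
      (Lp.coeFn_zero ℝ _ _).symm

theorem eq_of_inner_eq (hs : 0 < s) (hsd : s < (d : ℝ) / 2) {u v : HomSobolev d s}
    (h : ∀ w, inner ℝ u w = inner ℝ v w) : u = v := by
  refine toL2_injective hs hsd (sub_eq_zero.1 ?_)
  rw [← map_sub, ← norm_eq_zero, LinearIsometry.norm_map, ← sq_eq_zero_iff,
    ← real_inner_self_eq_norm_sq, inner_sub_left, h, sub_self]

theorem toL2_neg (u : HomSobolev d s) : ∀ᵐ ξ, toL2 d s u (-ξ) = conj (toL2 d s u ξ) := by
  have hneg := (Measure.measurePreserving_neg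
    (volume : Measure (𝔼 d))).quasiMeasurePreserving.ae u.coeFn_toL2
  filter_upwards [u.coeFn_toL2, hneg, u.isDistribFourier_fourier.ae_neg] with ξ hξ hnegξ hsymm
  rw [hξ, hnegξ, hsymm]
  simp only [freqWeight, norm_neg, Complex.real_smul, map_mul, Complex.conj_ofReal]

end HomSobolev

theorem integral_hermitianPart_mul_conj {h k : 𝔼 d → ℂ} (hk : ∀ᵐ ξ, k (-ξ) = conj (k ξ))
    (hi : Integrable fun ξ => h ξ * conj (k ξ)) :
    ∫ ξ, (h ξ + conj (h (-ξ))) * conj (k ξ) = ((2 * ∫ ξ, (h ξ * conj (k ξ)).re : ℝ) : ℂ) := by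
  have hreflect : (fun ξ => conj (h (-ξ) * conj (k (-ξ)))) =ᵐ[volume]
      fun ξ => conj (h (-ξ)) * conj (k ξ) := by
    filter_upwards [hk] with ξ hξ
    rw [hξ, map_mul, Complex.conj_conj]
  simp_rw [add_mul]
  rw [integral_add hi ((integrable_conj hi).comp_neg.congr hreflect),
    ← integral_congr_ae hreflect, integral_neg_eq_self (fun ξ => conj (h ξ * conj (k ξ))),
    integral_conj, Complex.add_conj]
  congr 2
  exact (integral_re hi).symm

theorem HomSobolev.integral_hermitianPart_mul_conj_toL2 (h : Lp (α := 𝔼 d) ℂ 2 volume)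
    (u : HomSobolev d s) :
    ∫ ξ, (h ξ + conj (h (-ξ))) * conj (toL2 d s u ξ) =
      ((2 * inner ℝ (toL2 d s u) h : ℝ) : ℂ) := by
  rw [integral_hermitianPart_mul_conj u.toL2_neg
    ((Lp.memLp h).integrable_mul (Lp.memLp (toL2 d s u)).star), L2.inner_def]
  simp_rw [Complex.inner]

theorem half_le_cos_two_pi_mul {r : ℝ} (hr : |r| ≤ 1 / 8) :
    1 / 2 ≤ Real.cos (-2 * Real.pi * r) := by
  have : (-2 * Real.pi * r) ^ 2 ≤ 1 := by
    rw [sq_le_one_iff_abs_le_one, abs_mul, abs_mul, abs_neg, abs_two, abs_of_pos Real.pi_pos]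
    nlinarith [Real.pi_lt_four, Real.pi_pos, abs_nonneg r]
  linarith [Real.one_sub_sq_div_two_le_cos (x := -2 * Real.pi * r)]

theorem half_integral_le_re_fourier {b : 𝔼 d → ℝ} (hb : Integrable b) (hb0 : ∀ x, 0 ≤ b x)
    {ξ : 𝔼 d} (hξ : ∀ x, b x ≠ 0 → ‖x‖ * ‖ξ‖ ≤ 1 / 8) :
    (1 / 2) * ∫ x, b x ≤ (𝓕 (fun x => (b x : ℂ)) ξ).re := by
  have hi : Integrable fun x : 𝔼 d =>
      Complex.exp (↑(-2 * Real.pi * inner ℝ x ξ) * Complex.I) • (b x : ℂ) :=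
    hb.ofReal.bdd_mul (c := 1) (Continuous.aestronglyMeasurable (by fun_prop))
      (Eventually.of_forall fun x => (Complex.norm_exp_ofReal_mul_I _).le)
  rw [Real.fourier_eq', ← integral_const_mul, ← RCLike.re_to_complex, ← integral_re hi]
  refine integral_mono (hb.const_mul _) hi.re fun x => ?_
  simp only [smul_eq_mul, RCLike.re_to_complex, Complex.re_mul_ofReal,
    Complex.exp_ofReal_mul_I_re]
  by_cases hx : b x = 0
  · simp [hx]
  · exact mul_le_mul_of_nonneg_right
      (half_le_cos_two_pi_mul ((abs_real_inner_le_norm x ξ).trans (hξ x hx))) (hb0 x)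

theorem exists_test_fourier_ne_zero (d : ℕ) {R : ℝ} (hR : 0 < R) :
    ∃ ρ : 𝔼 d → ℝ, ContDiff ℝ ∞ ρ ∧ HasCompactSupport ρ ∧
      ∀ ξ, ‖ξ‖ < R → 𝓕 (fun x => (ρ x : ℂ)) ξ ≠ 0 := by
  let b : ContDiffBump (0 : 𝔼 d) :=
    ⟨1 / (16 * R), 1 / (8 * R), by positivity, by gcongr; norm_num⟩
  refine ⟨b, b.contDiff, b.hasCompactSupport, fun ξ hξ h0 => ?_⟩
  have hsmall : ∀ x, b x ≠ 0 → ‖x‖ * ‖ξ‖ ≤ 1 / 8 := fun x hx => by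
    have hx' : x ∈ Metric.ball (0 : 𝔼 d) (1 / (8 * R)) := b.support_eq ▸ hx
    rw [mem_ball_zero_iff] at hx'
    calc ‖x‖ * ‖ξ‖ ≤ 1 / (8 * R) * R := by gcongr
      _ = 1 / 8 := by field_simp
  have hlower := half_integral_le_re_fourier b.integrable (fun _ => b.nonneg) hsmall
  rw [h0, Complex.zero_re] at hlower
  linarith [b.integral_pos (μ := volume)]

theorem fourier_comp_add_right (f : 𝔼 d → ℂ) (a ξ : 𝔼 d) :
    𝓕 (fun x => f (x + a)) ξ = Real.fourierChar (inner ℝ a ξ) • 𝓕 f ξ :=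
  congrFun (VectorFourier.fourierIntegral_comp_add_right Real.fourierChar volume (innerₗ _) f a) ξ

theorem ae_mul_conj_fourier_test_eq_zero [NeZero d] (hs : 0 < s) {F : 𝔼 d → ℂ} (hF : MemLp F 2)
    (h : ∀ φ (hφ : ContDiff ℝ ∞ φ) (hc : HasCompactSupport φ),
      ∫ ξ, F ξ * conj (freqWeight s ξ • 𝓕 (testToSchwartz hφ hc) ξ) = 0)
    {ρ : 𝔼 d → ℝ} (hρ : ContDiff ℝ ∞ ρ) (hc : HasCompactSupport ρ) :
    ∀ᵐ ξ, F ξ * conj (freqWeight s ξ • 𝓕 (testToSchwartz hρ hc) ξ) = 0 := by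
  have : 0 ≤ (d : ℝ) := Nat.cast_nonneg d
  refine ae_eq_zero_of_fourier_eq_zero (hF.integrable_mul
    (memLp_two_freqWeight_smul_schwartz (by linarith) (𝓕 (testToSchwartz hρ hc))).star) fun a => ?_
  have hρa : ContDiff ℝ ∞ fun x => ρ (x + a) := hρ.comp (contDiff_id.add contDiff_const)
  have hca : HasCompactSupport fun x => ρ (x + a) := hc.comp_homeomorph (Homeomorph.addRight a)
  have htrans : ∀ ξ, 𝓕 (testToSchwartz hρa hca) ξ =
      Real.fourierChar (inner ℝ a ξ) • 𝓕 (testToSchwartz hρ hc) ξ := fun ξ => by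
    rw [SchwartzMap.fourier_coe, SchwartzMap.fourier_coe]
    exact fourier_comp_add_right (fun x => (ρ x : ℂ)) a ξ
  rw [Real.fourier_eq, ← h _ hρa hca]
  refine integral_congr_ae (Eventually.of_forall fun ξ => ?_)
  simp only [htrans, Circle.smul_def, Complex.real_smul, smul_eq_mul, map_mul,
    ← Circle.coe_inv_eq_conj, AddChar.map_neg_eq_inv, real_inner_comm a ξ]
  ring

theorem ae_eq_zero_of_integral_freqWeight_test_eq_zero [NeZero d] (hs : 0 < s) {F : 𝔼 d → ℂ}
    (hF : MemLp F 2) (h : ∀ φ (hφ : ContDiff ℝ ∞ φ) (hc : HasCompactSupport φ),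
      ∫ ξ, F ξ * conj (freqWeight s ξ • 𝓕 (testToSchwartz hφ hc) ξ) = 0) :
    F =ᵐ[volume] 0 := by
  have hball : ∀ n : ℕ, ∀ᵐ ξ, ‖ξ‖ < (n : ℝ) + 1 → F ξ = 0 := fun n => by
    obtain ⟨ρ, hρ, hc, hne⟩ := exists_test_fourier_ne_zero d (R := n + 1) (by positivity)
    filter_upwards [ae_mul_conj_fourier_test_eq_zero hs hF h hρ hc, ae_ne_zero] with ξ hz hξ hn
    refine (mul_eq_zero.1 hz).resolve_right ((map_ne_zero _).2 ?_)
    exact smul_ne_zero (freqWeight_pos s hξ).ne' (hne ξ hn)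
  filter_upwards [ae_all_iff.2 hball] with ξ hξ
  obtain ⟨n, hn⟩ := exists_nat_gt ‖ξ‖
  exact hξ n (by linarith)

namespace HomSobolev

/-- The elements of `H̊ˢ(ℝᵈ)` represented by a function in `C_c^∞(ℝᵈ)`. -/
def testFunctions (d : ℕ) (s : ℝ) : Set (HomSobolev d s) :=
  {u | ∃ φ : 𝔼 d → ℝ, ContDiff ℝ ∞ φ ∧ HasCompactSupport φ ∧ u =ᵐ[volume] φ}

-- The Fourier transform of a real function is Hermitian, hence only sees the Hermitian part of `h`.
theorem inner_toL2_eq_zero_of_testFunctions [NeZero d] (hs : 0 < s)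
    {h : Lp (α := 𝔼 d) ℂ 2 volume} (hh : ∀ v ∈ testFunctions d s, inner ℝ (toL2 d s v) h = 0)
    (u : HomSobolev d s) : inner ℝ (toL2 d s u) h = 0 := by
  have hF : (fun ξ => h ξ + conj (h (-ξ))) =ᵐ[volume] 0 := by
    refine ae_eq_zero_of_integral_freqWeight_test_eq_zero hs ((Lp.memLp h).add
      ((Lp.memLp h).comp_measurePreserving (Measure.measurePreserving_neg _)).star)
      fun φ hφ hc => ?_
    obtain ⟨v, hv⟩ := exists_test hs hφ hc
    have hpair := integral_hermitianPart_mul_conj_toL2 h v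
    rw [hh v ⟨φ, hφ, hc, hv⟩, mul_zero, Complex.ofReal_zero] at hpair
    rw [← hpair]
    refine integral_congr_ae ?_
    filter_upwards [coeFn_toL2_of_ae_eq hv (isDistribFourier_test hφ hc)] with ξ hξ
    rw [hξ]
  have hpair := integral_hermitianPart_mul_conj_toL2 h u
  rw [integral_eq_zero_of_ae (hF.mono fun ξ hξ => by simp [hξ])] at hpair
  linarith [Complex.ofReal_eq_zero.1 hpair.symm]

theorem dense_span_testFunctions [NeZero d] (hs : 0 < s) :
    Dense (Submodule.span ℝ (testFunctions d s) : Set (HomSobolev d s)) := fun u => by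
  rw [(toL2 d s).isometry.isUniformInducing.isInducing.closure_eq_preimage_closure_image]
  suffices hu : toL2 d s u ∈
      ((Submodule.span ℝ (testFunctions d s)).map (toL2 d s).toLinearMap)ᗮᗮ by
    rwa [Submodule.orthogonal_orthogonal_eq_closure] at hu
  rw [Submodule.mem_orthogonal']
  exact fun h hh => inner_toL2_eq_zero_of_testFunctions hs
    (fun v hv => hh _ (Submodule.mem_map_of_mem (Submodule.subset_span hv))) u

theorem Extends.unique [NeZero d] (hs : 0 < s) {L L' : StrongDual ℝ (HomSobolev d s)}
    {T : 𝔼 d → ℝ} (hL : Extends L T) (hL' : Extends L' T) : L' = L := by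
  refine ContinuousLinearMap.ext_on (dense_span_testFunctions hs) ?_
  rintro u ⟨φ, hφ, hc, hu⟩
  obtain ⟨v, hv, hLv⟩ := hL φ hφ hc
  obtain ⟨w, hw, hLw⟩ := hL' φ hφ hc
  obtain rfl : v = u := ext_ae (hv.trans hu.symm)
  obtain rfl : w = v := ext_ae (hw.trans hu.symm)
  rw [hLv, hLw]

end HomSobolev

/-! ### Riesz potentials and energies of signed functions -/

section Energy

variable {α : ℝ} {f g : 𝔼 d → ℝ≥0∞} {S T : 𝔼 d → ℝ}

theorem rieszAbsEnergy_eq_lrieszEnergy (α : ℝ) (T : 𝔼 d → ℝ) :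
    rieszAbsEnergy α T = lrieszEnergy α (fun x => ‖T x‖ₑ) := by
  simp_rw [lrieszEnergy, lrieszPotential, Real.enorm_eq_ofReal_abs]
  rfl

theorem lrieszPotential_mono (α : ℝ) (h : f ≤ g) (x : 𝔼 d) :
    lrieszPotential α f x ≤ lrieszPotential α g x :=
  lintegral_mono fun y => by gcongr; exact h y

theorem lrieszEnergy_mono (α : ℝ) (h : f ≤ g) : lrieszEnergy α f ≤ lrieszEnergy α g :=
  lintegral_mono fun x => mul_le_mul' (lrieszPotential_mono α h x) (h x)

theorem ae_lrieszPotential_ne_top (hs : 0 < s) (hsd : s < (d : ℝ) / 2) (hf : Measurable f)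
    (hE : lrieszEnergy (2 * s) f ≠ ⊤) : ∀ᵐ x, lrieszPotential (2 * s) f x ≠ ⊤ := by
  have hp : 0 < 2 * (d : ℝ) / (d - 2 * s) := div_pos (by linarith) (by linarith)
  filter_upwards [ae_lt_top ((measurable_lrieszPotential _ hf).pow_const _)
    (lintegral_lrieszPotential_rpow_lt_top hs hsd hf hE).ne] with x hx
  exact ((ENNReal.rpow_lt_top_iff_of_pos hp).1 hx).ne

theorem memLp_toReal_lrieszPotential (hs : 0 < s) (hsd : s < (d : ℝ) / 2) (hf : Measurable f)
    (hE : lrieszEnergy (2 * s) f ≠ ⊤) :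
    MemLp (fun x => (lrieszPotential (2 * s) f x).toReal)
      (ENNReal.ofReal (2 * d / (d - 2 * s))) := by
  have hp : 0 < 2 * (d : ℝ) / (d - 2 * s) := div_pos (by linarith) (by linarith)
  refine ⟨(measurable_lrieszPotential _ hf).ennreal_toReal.aestronglyMeasurable, ?_⟩
  rw [eLpNorm_lt_top_iff_lintegral_rpow_enorm_lt_top (by simpa using hp) ENNReal.ofReal_ne_top,
    ENNReal.toReal_ofReal hp.le]
  refine lt_of_eq_of_lt (lintegral_congr_ae ?_)
    (lintegral_lrieszPotential_rpow_lt_top hs hsd hf hE)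
  filter_upwards [ae_lrieszPotential_ne_top hs hsd hf hE] with x hx
  rw [Real.enorm_toReal hx]

theorem integrable_toReal_lrieszPotential_mul_schwartz (hs : 0 < s) (hsd : s < (d : ℝ) / 2)
    (hf : Measurable f) (hE : lrieszEnergy (2 * s) f ≠ ⊤) (φ : 𝓢(𝔼 d, ℂ)) :
    Integrable fun x => (lrieszPotential (2 * s) f x).toReal * ‖φ x‖ := by
  have := ENNReal.HolderConjugate.conjExponent (HomSobolev.one_le_exponent hs hsd)
  exact (memLp_toReal_lrieszPotential hs hsd hf hE).integrable_mul
    (φ.memLp (ENNReal.conjExponent (ENNReal.ofReal (2 * d / (d - 2 * s))))).norm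

theorem enorm_rieszKernel_smul {F : Type*} [NormedAddCommGroup F] [NormedSpace ℝ F]
    (hα : 0 ≤ α) (hαd : α ≤ d) (z : 𝔼 d) (v : F) :
    ‖rieszKernel d α z • v‖ₑ = ENNReal.ofReal (rieszKernel d α z) * ‖v‖ₑ := by
  rw [enorm_smul, Real.enorm_of_nonneg (rieszKernel_nonneg hα hαd z)]

theorem lintegral_enorm_rieszKernel_smul_mul {𝕜 : Type*} [RCLike 𝕜] (hα : 0 ≤ α) (hαd : α ≤ d)
    {u v : 𝔼 d → 𝕜} (hu : Measurable u) (hv : Measurable v) :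
    ∫⁻ p : 𝔼 d × 𝔼 d, ‖rieszKernel d α (p.1 - p.2) • (u p.1 * v p.2)‖ₑ =
      ∫⁻ x, lrieszPotential α (fun y => ‖v y‖ₑ) x * ‖u x‖ₑ := by
  rw [Measure.volume_eq_prod, lintegral_prod _ (by fun_prop)]
  refine lintegral_congr fun x => ?_
  rw [lrieszPotential, ← lintegral_mul_const _ (by fun_prop)]
  refine lintegral_congr fun y => ?_
  rw [enorm_rieszKernel_smul hα hαd, enorm_mul, mul_assoc, mul_comm ‖v y‖ₑ]

theorem integrable_rieszKernel_mul (hα : 0 ≤ α) (hαd : α ≤ d) (hT : Measurable T) {x : 𝔼 d}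
    (hx : lrieszPotential α (fun y => ‖T y‖ₑ) x ≠ ⊤) :
    Integrable fun y => rieszKernel d α (x - y) * T y := by
  refine ⟨Measurable.aestronglyMeasurable (by fun_prop), ?_⟩
  rw [hasFiniteIntegral_iff_enorm]
  simp_rw [← smul_eq_mul, enorm_rieszKernel_smul hα hαd]
  exact hx.lt_top

theorem stronglyMeasurable_rieszPotential (α : ℝ) (hT : Measurable T) :
    StronglyMeasurable (rieszPotential α T) :=
  StronglyMeasurable.integral_prod_right (f := fun x y => rieszKernel d α (x - y) * T y)
    (Measurable.stronglyMeasurable (by unfold Function.uncurry; fun_prop))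

theorem enorm_rieszPotential_le (hα : 0 ≤ α) (hαd : α ≤ d) (T : 𝔼 d → ℝ) (x : 𝔼 d) :
    ‖rieszPotential α T x‖ₑ ≤ lrieszPotential α (fun y => ‖T y‖ₑ) x := by
  refine (enorm_integral_le_lintegral_enorm _).trans_eq ?_
  simp_rw [← smul_eq_mul, enorm_rieszKernel_smul hα hαd]
  rfl

theorem norm_rieszPotential_le (hα : 0 ≤ α) (hαd : α ≤ d) (hS : ∀ y, ‖S y‖ₑ ≤ f y) {x : 𝔼 d}
    (hx : lrieszPotential α f x ≠ ⊤) :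
    ‖rieszPotential α S x‖ ≤ (lrieszPotential α f x).toReal := by
  rw [← toReal_enorm]
  exact ENNReal.toReal_mono hx
    ((enorm_rieszPotential_le hα hαd S x).trans (lrieszPotential_mono α hS x))

theorem memLp_rieszPotential (hs : 0 < s) (hsd : s < (d : ℝ) / 2) (hT : Measurable T)
    (hE : lrieszEnergy (2 * s) (fun x => ‖T x‖ₑ) ≠ ⊤) :
    MemLp (rieszPotential (2 * s) T) (ENNReal.ofReal (2 * d / (d - 2 * s))) := by
  refine (memLp_toReal_lrieszPotential hs hsd hT.enorm hE).mono
    (stronglyMeasurable_rieszPotential _ hT).aestronglyMeasurable ?_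
  filter_upwards [ae_lrieszPotential_ne_top hs hsd hT.enorm hE] with x hx
  exact (norm_rieszPotential_le (by linarith) (by linarith) (fun _ => le_rfl) hx).trans
    (Real.le_norm_self _)

theorem integrable_rieszKernel_smul_self (hα : 0 ≤ α) (hαd : α ≤ d) (hT : Measurable T)
    (hE : lrieszEnergy α (fun x => ‖T x‖ₑ) ≠ ⊤) :
    Integrable fun p : 𝔼 d × 𝔼 d => rieszKernel d α (p.1 - p.2) • (T p.1 * T p.2) := by
  refine ⟨Measurable.aestronglyMeasurable (by fun_prop), ?_⟩
  rw [hasFiniteIntegral_iff_enorm, lintegral_enorm_rieszKernel_smul_mul hα hαd hT hT]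
  exact hE.lt_top

theorem integral_rieszKernel_smul_mul_ofReal {𝕜 : Type*} [RCLike 𝕜] (α : ℝ) (S : 𝔼 d → ℝ) (c : 𝕜)
    (x : 𝔼 d) :
    ∫ y, rieszKernel d α (x - y) • (c * (S y : 𝕜)) = (rieszPotential α S x : 𝕜) * c := by
  rw [rieszPotential, ← integral_ofReal, ← integral_mul_const]
  refine integral_congr_ae (Eventually.of_forall fun y => ?_)
  simp only [RCLike.real_smul_eq_coe_mul, RCLike.ofReal_mul]
  ring

theorem integrable_rieszPotential_mul (hα : 0 ≤ α) (hαd : α ≤ d) (hT : Measurable T)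
    (hE : lrieszEnergy α (fun x => ‖T x‖ₑ) ≠ ⊤) :
    Integrable fun x => rieszPotential α T x * T x :=
  (integrable_rieszKernel_smul_self hα hαd hT hE).integral_prod_left.congr
    (Eventually.of_forall fun x => integral_rieszKernel_smul_mul_ofReal α T (T x) x)

theorem integral_rieszKernel_smul_self_eq_rieszEnergy (hα : 0 ≤ α) (hαd : α ≤ d)
    (hT : Measurable T) (hE : lrieszEnergy α (fun x => ‖T x‖ₑ) ≠ ⊤) :
    ∫ p : 𝔼 d × 𝔼 d, rieszKernel d α (p.1 - p.2) • (T p.1 * T p.2) = rieszEnergy α T := by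
  have hI := integrable_rieszKernel_smul_self hα hαd hT hE
  rw [Measure.volume_eq_prod] at hI ⊢
  rw [integral_prod _ hI]
  exact integral_congr_ae
    (Eventually.of_forall fun x => integral_rieszKernel_smul_mul_ofReal α T (T x) x)

end Energy

/-! ### The Fourier transform of a Riesz potential -/

section FourierTransform

variable {S T : 𝔼 d → ℝ}

theorem integrable_rieszKernel_smul_schwartz_mul (hs : 0 < s) (hsd : s < (d : ℝ) / 2)
    (hS : Measurable S) (hE : lrieszEnergy (2 * s) (fun x => ‖S x‖ₑ) ≠ ⊤) (φ : 𝓢(𝔼 d, ℂ)) :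
    Integrable fun p : 𝔼 d × 𝔼 d => rieszKernel d (2 * s) (p.1 - p.2) • (φ p.1 * (S p.2 : ℂ)) := by
  have hφ : Measurable φ := φ.continuous.measurable
  refine ⟨Measurable.aestronglyMeasurable (by fun_prop), ?_⟩
  rw [hasFiniteIntegral_iff_enorm,
    lintegral_enorm_rieszKernel_smul_mul (by linarith) (by linarith) hφ
      (v := fun x => (S x : ℂ)) (by fun_prop)]
  refine lt_of_eq_of_lt (lintegral_congr_ae ?_)
    (integrable_toReal_lrieszPotential_mul_schwartz hs hsd hS.enorm hE φ).hasFiniteIntegral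
  filter_upwards [ae_lrieszPotential_ne_top hs hsd hS.enorm hE] with x hx
  rw [enorm_mul, enorm_norm, Real.enorm_toReal hx]
  simp only [← ofReal_norm, Complex.norm_real]

theorem integrable_freqWeight_smul_schwartz_mul_fourier [NeZero d] {a : ℝ} (ha : -(d : ℝ) < a)
    {k : 𝔼 d → ℂ} (hk : Integrable k) (φ : 𝓢(𝔼 d, ℂ)) :
    Integrable fun ξ => freqWeight a ξ • (φ ξ * 𝓕 k ξ) := by
  simp_rw [← smul_mul_assoc]
  exact (integrable_freqWeight_smul_schwartz ha φ).mul_bdd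
    (continuous_fourier_of_integrable hk).aestronglyMeasurable
    (Eventually.of_forall (norm_fourier_le k))

theorem fourier_fourier_schwartz (φ : 𝓢(𝔼 d, ℂ)) (ξ : 𝔼 d) :
    𝓕 ((𝓕 φ : 𝓢(𝔼 d, ℂ)) : 𝔼 d → ℂ) ξ = φ (-ξ) := by
  have h : 𝓕⁻ (𝓕 φ : 𝓢(𝔼 d, ℂ)) = φ := FourierTransform.fourierInv_fourier_eq _
  rw [← DFunLike.congr_fun h (-ξ), SchwartzMap.fourierInv_coe, Real.fourierInv_eq_fourier_neg,
    neg_neg]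

theorem integral_freqWeight_smul_fourier_mul_schwartz (hs : 0 < s) (hsd : s < (d : ℝ) / 2)
    (hS : Measurable S) (hSi : Integrable S)
    (hE : lrieszEnergy (2 * s) (fun x => ‖S x‖ₑ) ≠ ⊤) (φ : 𝓢(𝔼 d, ℂ)) :
    ∫ ξ, freqWeight (-(2 * s)) ξ • (φ ξ * 𝓕 (fun x => (S x : ℂ)) ξ) =
      ∫ x, (rieszPotential (2 * s) S x : ℂ) * (𝓕 φ : 𝓢(𝔼 d, ℂ)) x := by
  have := neZero_of_lt_half hs hsd
  have hSc : Integrable fun x => (S x : ℂ) := hSi.ofReal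
  have hI := integrable_rieszKernel_smul_schwartz_mul hs hsd hS hE (𝓕 φ)
  have hneg : (fun ξ => freqWeight (-(2 * s)) ξ • (𝓕 ((𝓕 φ : 𝓢(𝔼 d, ℂ)) : 𝔼 d → ℂ) ξ *
      𝓕 (fun x => (S x : ℂ)) (-ξ))) =
      fun ξ => freqWeight (-(2 * s)) (-ξ) • (φ (-ξ) * 𝓕 (fun x => (S x : ℂ)) (-ξ)) := by
    funext ξ
    rw [fourier_fourier_schwartz, freqWeight, freqWeight, norm_neg]
  have hW := (integrable_freqWeight_smul_schwartz_mul_fourier (a := -(2 * s)) (by linarith)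
    hSc φ).comp_neg
  have h := integral_rieszKernel_smul hs hsd (𝓕 φ).integrable hSc hI (hneg ▸ hW)
  rw [hneg, integral_neg_eq_self
    (fun ξ => freqWeight (-(2 * s)) ξ • (φ ξ * 𝓕 (fun x => (S x : ℂ)) ξ))] at h
  rw [← h, Measure.volume_eq_prod, integral_prod _ hI]
  exact integral_congr_ae (Eventually.of_forall fun x =>
    integral_rieszKernel_smul_mul_ofReal (2 * s) S ((𝓕 φ : 𝓢(𝔼 d, ℂ)) x) x)

/-- The function `|ξ|^(-s) 𝓕 f`, whose `L²` norm is the square root of the energy of `f`; it stands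
for `(-Δ)^(-s/2) f` on the Fourier side. -/
noncomputable def weightedFourier (s : ℝ) (f : 𝔼 d → ℝ) (ξ : 𝔼 d) : ℂ :=
  freqWeight (-s) ξ • 𝓕 (fun x => (f x : ℂ)) ξ

theorem memLp_weightedFourier (hs : 0 < s) (hsd : s < (d : ℝ) / 2) (hS : Measurable S)
    (hSi : Integrable S) (hE : lrieszEnergy (2 * s) (fun x => ‖S x‖ₑ) ≠ ⊤) :
    MemLp (weightedFourier s S) 2 := by
  have hSc : Integrable fun x => (S x : ℂ) := hSi.ofReal
  refine (memLp_two_freqWeight_smul_iff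
    (continuous_fourier_of_integrable hSc).aestronglyMeasurable).2 ?_
  have := integrable_freqWeight_smul_norm_fourier_sq hs hsd hSi
    (integrable_rieszKernel_smul_self (by linarith) (by linarith) hS hE)
  simpa only [mul_neg, smul_eq_mul] using this

theorem norm_toLp_weightedFourier_sq (hs : 0 < s) (hsd : s < (d : ℝ) / 2) (hS : Measurable S)
    (hSi : Integrable S) (hE : lrieszEnergy (2 * s) (fun x => ‖S x‖ₑ) ≠ ⊤) :
    ‖(memLp_weightedFourier hs hsd hS hSi hE).toLp‖ ^ 2 = rieszEnergy (2 * s) S := by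
  have h0 : 0 ≤ 2 * s := by linarith
  have hd : 2 * s ≤ d := by linarith
  rw [← integral_rieszKernel_smul_self_eq_rieszEnergy h0 hd hS hE,
    integral_rieszKernel_smul_self hs hsd hSi (integrable_rieszKernel_smul_self h0 hd hS hE),
    ← real_inner_self_eq_norm_sq, L2.inner_def]
  refine integral_congr_ae ?_
  filter_upwards [(memLp_weightedFourier hs hsd hS hSi hE).coeFn_toLp] with ξ hξ
  rw [hξ, real_inner_self_eq_norm_sq, weightedFourier, norm_freqWeight_smul_sq, mul_neg,
    smul_eq_mul]

theorem weightedFourier_sub (s : ℝ) (hS : Integrable S) (hT : Integrable T) :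
    weightedFourier s (S - T) = weightedFourier s S - weightedFourier s T := by
  funext ξ
  simp only [weightedFourier, Pi.sub_apply, ← smul_sub, Complex.ofReal_sub, Real.fourier_eq]
  rw [← integral_sub ((Real.fourierIntegral_convergent_iff ξ).2 hS.ofReal)
    ((Real.fourierIntegral_convergent_iff ξ).2 hT.ofReal)]
  simp_rw [smul_sub]

end FourierTransform

/-! ### Approximation by truncation -/

section Truncation

variable {α : ℝ} {T : 𝔼 d → ℝ}

theorem tendsto_rieszPotential_of_dominated (hα : 0 ≤ α) (hαd : α ≤ d) {ι : Type*}
    {l : Filter ι} [l.IsCountablyGenerated] {S : ι → 𝔼 d → ℝ} {L : 𝔼 d → ℝ}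
    (hS : ∀ i, Measurable (S i)) (hT : Measurable T) (hST : ∀ i x, ‖S i x‖ ≤ ‖T x‖)
    (hlim : ∀ x, Tendsto (fun i => S i x) l (nhds (L x))) {x : 𝔼 d}
    (hx : lrieszPotential α (fun y => ‖T y‖ₑ) x ≠ ⊤) :
    Tendsto (fun i => rieszPotential α (S i) x) l (nhds (rieszPotential α L x)) := by
  refine tendsto_integral_filter_of_dominated_convergence _
    (Eventually.of_forall fun i => Measurable.aestronglyMeasurable (by fun_prop))
    (Eventually.of_forall fun i => Eventually.of_forall fun y => ?_)
    (integrable_rieszKernel_mul hα hαd hT hx).norm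
    (Eventually.of_forall fun y => (hlim y).const_mul _)
  rw [norm_mul, norm_mul]
  gcongr
  exact hST i y

theorem tendsto_rieszEnergy_of_dominated (hα : 0 ≤ α) (hαd : α ≤ d) {ι : Type*}
    {l : Filter ι} [l.NeBot] [l.IsCountablyGenerated] {S : ι → 𝔼 d → ℝ} {L : 𝔼 d → ℝ}
    (hS : ∀ i, Measurable (S i)) (hT : Measurable T)
    (hE : lrieszEnergy α (fun x => ‖T x‖ₑ) ≠ ⊤) (hST : ∀ i x, ‖S i x‖ ≤ ‖T x‖)
    (hlim : ∀ x, Tendsto (fun i => S i x) l (nhds (L x))) :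
    Tendsto (fun i => rieszEnergy α (S i)) l (nhds (rieszEnergy α L)) := by
  have hL : Measurable L := measurable_of_tendsto_metrizable' l hS (tendsto_pi_nhds.2 hlim)
  have hLT : ∀ x, ‖L x‖ ≤ ‖T x‖ := fun x => le_of_tendsto' (hlim x).norm fun i => hST i x
  have finite : ∀ {F : 𝔼 d → ℝ}, (∀ x, ‖F x‖ ≤ ‖T x‖) → lrieszEnergy α (fun x => ‖F x‖ₑ) ≠ ⊤ :=
    fun hF => ne_top_of_le_ne_top hE (lrieszEnergy_mono α fun x => enorm_le_iff_norm_le.2 (hF x))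
  simp_rw [← integral_rieszKernel_smul_self_eq_rieszEnergy hα hαd hL (finite hLT),
    ← fun i => integral_rieszKernel_smul_self_eq_rieszEnergy hα hαd (hS i) (finite (hST i))]
  refine tendsto_integral_filter_of_dominated_convergence _
    (Eventually.of_forall fun i => Measurable.aestronglyMeasurable (by fun_prop))
    (Eventually.of_forall fun i => Eventually.of_forall fun p => ?_)
    (integrable_rieszKernel_smul_self hα hαd hT hE).norm
    (Eventually.of_forall fun p => ((hlim p.1).mul (hlim p.2)).const_smul _)
  rw [norm_smul, norm_smul, norm_mul, norm_mul]
  gcongr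
  exacts [hST i p.1, hST i p.2]

/-- The restriction of `T` to the ball of radius `n`, extended by zero. It is integrable when `T`
is locally integrable, so that its Fourier transform is given by an integral. -/
noncomputable def truncate (T : 𝔼 d → ℝ) (n : ℕ) : 𝔼 d → ℝ :=
  (Metric.ball 0 n).indicator T

@[fun_prop]
theorem measurable_truncate (hT : Measurable T) (n : ℕ) : Measurable (truncate T n) :=
  hT.indicator measurableSet_ball

theorem norm_truncate_le (T : 𝔼 d → ℝ) (n : ℕ) (x : 𝔼 d) : ‖truncate T n x‖ ≤ ‖T x‖ :=
  norm_indicator_le_norm_self T x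

theorem norm_truncate_sub_truncate_le (T : 𝔼 d → ℝ) (n m : ℕ) (x : 𝔼 d) :
    ‖(truncate T n - truncate T m) x‖ ≤ ‖T x‖ := by
  simp only [truncate, Pi.sub_apply, indicator]
  split_ifs <;> simp

theorem integrable_truncate (hT : LocallyIntegrable T) (n : ℕ) : Integrable (truncate T n) :=
  (integrable_indicator_iff measurableSet_ball).2
    ((hT.integrableOn_isCompact (isCompact_closedBall 0 (n : ℝ))).mono_set
      Metric.ball_subset_closedBall)

theorem tendsto_truncate (T : 𝔼 d → ℝ) (x : 𝔼 d) :
    Tendsto (fun n => truncate T n x) atTop (nhds (T x)) := by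
  refine tendsto_const_nhds.congr' ?_
  filter_upwards [tendsto_natCast_atTop_atTop.eventually_gt_atTop ‖x‖] with n hn
  rw [truncate, indicator_of_mem (by simpa using hn)]

theorem tendsto_truncate_sub_truncate (T : 𝔼 d → ℝ) (x : 𝔼 d) :
    Tendsto (fun n : ℕ × ℕ => (truncate T n.1 - truncate T n.2) x) atTop (nhds 0) := by
  rw [← prod_atTop_atTop_eq, ← sub_self (T x)]
  exact ((tendsto_truncate T x).comp tendsto_fst).sub ((tendsto_truncate T x).comp tendsto_snd)

theorem tendsto_integral_truncate_mul {φ : 𝔼 d → ℝ} (hT : Measurable T)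
    (hφ : Measurable φ) (hTφ : Integrable fun x => T x * φ x) :
    Tendsto (fun n => ∫ x, truncate T n x * φ x) atTop (nhds (∫ x, T x * φ x)) := by
  refine tendsto_integral_of_dominated_convergence _
    (fun n => Measurable.aestronglyMeasurable (by fun_prop)) hTφ.norm
    (fun n => Eventually.of_forall fun x => ?_)
    (Eventually.of_forall fun x => (tendsto_truncate T x).mul_const _)
  rw [norm_mul, norm_mul]
  gcongr
  exact norm_truncate_le T n x

theorem lrieszEnergy_truncate_ne_top (hE : lrieszEnergy α (fun x => ‖T x‖ₑ) ≠ ⊤) (n : ℕ) :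
    lrieszEnergy α (fun x => ‖truncate T n x‖ₑ) ≠ ⊤ :=
  ne_top_of_le_ne_top hE
    (lrieszEnergy_mono α fun x => enorm_le_iff_norm_le.2 (norm_truncate_le T n x))

theorem memLp_weightedFourier_truncate (hs : 0 < s) (hsd : s < (d : ℝ) / 2) (hT : Measurable T)
    (hTl : LocallyIntegrable T) (hE : lrieszEnergy (2 * s) (fun x => ‖T x‖ₑ) ≠ ⊤) (n : ℕ) :
    MemLp (weightedFourier s (truncate T n)) 2 :=
  memLp_weightedFourier hs hsd (measurable_truncate hT n) (integrable_truncate hTl n)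
    (lrieszEnergy_truncate_ne_top hE n)

theorem norm_toLp_weightedFourier_truncate_sub_sq (hs : 0 < s) (hsd : s < (d : ℝ) / 2)
    (hT : Measurable T) (hTl : LocallyIntegrable T)
    (hE : lrieszEnergy (2 * s) (fun x => ‖T x‖ₑ) ≠ ⊤) (n m : ℕ) :
    ‖(memLp_weightedFourier_truncate hs hsd hT hTl hE n).toLp -
      (memLp_weightedFourier_truncate hs hsd hT hTl hE m).toLp‖ ^ 2 =
      rieszEnergy (2 * s) (truncate T n - truncate T m) := by
  have hn := integrable_truncate hTl n
  have hm := integrable_truncate hTl m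
  rw [← norm_toLp_weightedFourier_sq hs hsd
    ((measurable_truncate hT n).sub (measurable_truncate hT m)) (hn.sub hm)
    (ne_top_of_le_ne_top hE (lrieszEnergy_mono _ fun x =>
      enorm_le_iff_norm_le.2 (norm_truncate_sub_truncate_le T n m x)))]
  simp_rw [weightedFourier_sub s hn hm]
  rfl

theorem exists_tendsto_weightedFourier_truncate (hs : 0 < s) (hsd : s < (d : ℝ) / 2)
    (hT : Measurable T) (hTl : LocallyIntegrable T)
    (hE : lrieszEnergy (2 * s) (fun x => ‖T x‖ₑ) ≠ ⊤) :
    ∃ h : Lp (α := 𝔼 d) ℂ 2 volume, ‖h‖ ^ 2 = rieszEnergy (2 * s) T ∧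
      Tendsto (fun n => (memLp_weightedFourier_truncate hs hsd hT hTl hE n).toLp) atTop
        (nhds h) := by
  have h0 : 0 ≤ 2 * s := by linarith
  have hd : 2 * s ≤ d := by linarith
  have hcauchy : CauchySeq fun n =>
      (memLp_weightedFourier_truncate hs hsd hT hTl hE n).toLp := by
    have hlim := tendsto_rieszEnergy_of_dominated h0 hd
      (fun n : ℕ × ℕ => (measurable_truncate hT n.1).sub (measurable_truncate hT n.2)) hT hE
      (fun n x => norm_truncate_sub_truncate_le T n.1 n.2 x) (tendsto_truncate_sub_truncate T)
    rw [cauchySeq_iff_tendsto_dist_atTop_0]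
    refine (hlim.sqrt.congr fun n => ?_).trans_eq ?_
    · rw [← norm_toLp_weightedFourier_truncate_sub_sq hs hsd hT hTl hE,
        Real.sqrt_sq (norm_nonneg _), dist_eq_norm]
    · simp [rieszEnergy]
  obtain ⟨h, hh⟩ := cauchySeq_tendsto_of_complete hcauchy
  refine ⟨h, tendsto_nhds_unique (hh.norm.pow 2) ?_, hh⟩
  refine (tendsto_rieszEnergy_of_dominated h0 hd (measurable_truncate hT) hT hE
    (norm_truncate_le T) (tendsto_truncate T)).congr fun n => ?_
  exact (norm_toLp_weightedFourier_sq hs hsd (measurable_truncate hT n) (integrable_truncate hTl n)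
    (lrieszEnergy_truncate_ne_top hE n)).symm

end Truncation

/-! ### The Riesz potential as an element of the Sobolev space -/

section Potential

variable {S T : 𝔼 d → ℝ}

theorem tendsto_integral_mul_of_tendsto_toLp {X ι : Type*} [MeasurableSpace X] {μ : Measure X}
    {l : Filter ι} {F : ι → X → ℂ} (hF : ∀ i, MemLp (F i) 2 μ) {h : Lp ℂ 2 μ}
    (hFh : Tendsto (fun i => (hF i).toLp) l (nhds h)) {k : X → ℂ} (hk : MemLp k 2 μ) :
    Tendsto (fun i => ∫ x, F i x * k x ∂μ) l (nhds (∫ x, h x * k x ∂μ)) := by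
  have inner_eq : ∀ {f : X → ℂ} {f' : Lp ℂ 2 μ}, f' =ᵐ[μ] f →
      inner ℂ hk.star.toLp f' = ∫ x, f x * k x ∂μ := fun hf => by
    rw [L2.inner_def]
    refine integral_congr_ae ?_
    filter_upwards [hk.star.coeFn_toLp, hf] with x hkx hfx
    rw [hkx, hfx, RCLike.inner_apply]
    simp
  simp_rw [← inner_eq (ae_eq_refl h), ← fun i => inner_eq (hF i).coeFn_toLp]
  exact tendsto_const_nhds.inner hFh

theorem locallyIntegrable_of_integrable_mul_schwartz {g : 𝔼 d → ℂ}
    (hg : ∀ φ : 𝓢(𝔼 d, ℂ), Integrable fun ξ => g ξ * φ ξ) : LocallyIntegrable g := by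
  intro x
  let b : ContDiffBump x := ⟨1, 2, one_pos, one_lt_two⟩
  refine ⟨Metric.closedBall x 1, Metric.closedBall_mem_nhds x one_pos, ?_⟩
  refine (hg (testToSchwartz b.contDiff b.hasCompactSupport)).integrableOn.congr_fun
    (fun ξ hξ => ?_) measurableSet_closedBall
  simp [b.one_of_mem_closedBall hξ]

theorem norm_rieszPotential_mul_schwartz_le (hs : 0 < s) (hsd : s < (d : ℝ) / 2)
    (hST : ∀ x, ‖S x‖ ≤ ‖T x‖) (φ : 𝓢(𝔼 d, ℂ)) {x : 𝔼 d}
    (hx : lrieszPotential (2 * s) (fun y => ‖T y‖ₑ) x ≠ ⊤) :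
    ‖(rieszPotential (2 * s) S x : ℂ) * φ x‖ ≤
      (lrieszPotential (2 * s) (fun y => ‖T y‖ₑ) x).toReal * ‖φ x‖ := by
  rw [norm_mul, Complex.norm_real]
  gcongr
  exact norm_rieszPotential_le (by linarith) (by linarith)
    (fun y => enorm_le_iff_norm_le.2 (hST y)) hx

theorem aestronglyMeasurable_rieszPotential_mul_schwartz (α : ℝ) (hT : Measurable T)
    (φ : 𝓢(𝔼 d, ℂ)) : AEStronglyMeasurable fun x => (rieszPotential α T x : ℂ) * φ x :=
  (Complex.continuous_ofReal.comp_stronglyMeasurable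
    (stronglyMeasurable_rieszPotential α hT)).aestronglyMeasurable.mul
    φ.continuous.aestronglyMeasurable

theorem integrable_rieszPotential_mul_schwartz (hs : 0 < s) (hsd : s < (d : ℝ) / 2)
    (hT : Measurable T) (hE : lrieszEnergy (2 * s) (fun x => ‖T x‖ₑ) ≠ ⊤) (φ : 𝓢(𝔼 d, ℂ)) :
    Integrable fun x => (rieszPotential (2 * s) T x : ℂ) * φ x := by
  refine (integrable_toReal_lrieszPotential_mul_schwartz hs hsd hT.enorm hE φ).mono'
    (aestronglyMeasurable_rieszPotential_mul_schwartz _ hT φ) ?_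
  filter_upwards [ae_lrieszPotential_ne_top hs hsd hT.enorm hE] with x hx
  exact norm_rieszPotential_mul_schwartz_le hs hsd (fun _ => le_rfl) φ hx

theorem tendsto_integral_rieszPotential_truncate_mul_schwartz (hs : 0 < s)
    (hsd : s < (d : ℝ) / 2) (hT : Measurable T)
    (hE : lrieszEnergy (2 * s) (fun x => ‖T x‖ₑ) ≠ ⊤) (φ : 𝓢(𝔼 d, ℂ)) :
    Tendsto (fun n => ∫ x, (rieszPotential (2 * s) (truncate T n) x : ℂ) * φ x) atTop
      (nhds (∫ x, (rieszPotential (2 * s) T x : ℂ) * φ x)) := by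
  have hfin := ae_lrieszPotential_ne_top hs hsd hT.enorm hE
  refine tendsto_integral_of_dominated_convergence _
    (fun n => aestronglyMeasurable_rieszPotential_mul_schwartz _ (measurable_truncate hT n) φ)
    (integrable_toReal_lrieszPotential_mul_schwartz hs hsd hT.enorm hE φ) (fun n => ?_) ?_
  · filter_upwards [hfin] with x hx
    exact norm_rieszPotential_mul_schwartz_le hs hsd (norm_truncate_le T n) φ hx
  · filter_upwards [hfin] with x hx
    exact ((Complex.continuous_ofReal.tendsto _).comp (tendsto_rieszPotential_of_dominated
      (by linarith) (by linarith) (measurable_truncate hT) hT (norm_truncate_le T)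
      (tendsto_truncate T) hx)).mul_const _

theorem integral_weightedFourier_mul_freqWeight_smul_schwartz (hs : 0 < s)
    (hsd : s < (d : ℝ) / 2) (hS : Measurable S) (hSi : Integrable S)
    (hE : lrieszEnergy (2 * s) (fun x => ‖S x‖ₑ) ≠ ⊤) (φ : 𝓢(𝔼 d, ℂ)) :
    ∫ ξ, weightedFourier s S ξ * freqWeight (-s) ξ • φ ξ =
      ∫ x, (rieszPotential (2 * s) S x : ℂ) * (𝓕 φ : 𝓢(𝔼 d, ℂ)) x := by
  rw [← integral_freqWeight_smul_fourier_mul_schwartz hs hsd hS hSi hE φ]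
  congr with ξ
  rw [weightedFourier, smul_mul_smul_comm, ← sq, freqWeight_sq, mul_neg, mul_comm (φ ξ)]

theorem isDistribFourier_rieszPotential (hs : 0 < s) (hsd : s < (d : ℝ) / 2)
    (hT : Measurable T) (hTl : LocallyIntegrable T)
    (hE : lrieszEnergy (2 * s) (fun x => ‖T x‖ₑ) ≠ ⊤) {h : Lp (α := 𝔼 d) ℂ 2 volume}
    (hh : Tendsto (fun n => (memLp_weightedFourier_truncate hs hsd hT hTl hE n).toLp) atTop
      (nhds h)) :
    IsDistribFourier (rieszPotential (2 * s) T) fun ξ => freqWeight (-s) ξ • h ξ := by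
  have := neZero_of_lt_half hs hsd
  have hφ : ∀ φ : 𝓢(𝔼 d, ℂ), MemLp (fun ξ => freqWeight (-s) ξ • φ ξ) 2 :=
    memLp_two_freqWeight_smul_schwartz (by linarith)
  have hmul : ∀ (φ : 𝓢(𝔼 d, ℂ)) (ξ : 𝔼 d),
      (freqWeight (-s) ξ • h ξ) * φ ξ = h ξ * freqWeight (-s) ξ • φ ξ := fun φ ξ => by
    rw [smul_mul_assoc, mul_smul_comm]
  have hint : ∀ φ : 𝓢(𝔼 d, ℂ), Integrable fun ξ => (freqWeight (-s) ξ • h ξ) * φ ξ := fun φ => by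
    simp_rw [hmul]
    exact (Lp.memLp h).integrable_mul (hφ φ)
  refine ⟨locallyIntegrable_of_integrable_mul_schwartz hint, fun φ =>
    ⟨integrable_rieszPotential_mul_schwartz hs hsd hT hE (𝓕 φ), hint φ, ?_⟩⟩
  simp_rw [hmul]
  refine tendsto_nhds_unique (tendsto_integral_mul_of_tendsto_toLp _ hh (hφ φ)) ?_
  simp_rw [fun n => integral_weightedFourier_mul_freqWeight_smul_schwartz hs hsd
    (measurable_truncate hT n) (integrable_truncate hTl n) (lrieszEnergy_truncate_ne_top hE n) φ]
  exact tendsto_integral_rieszPotential_truncate_mul_schwartz hs hsd hT hE (𝓕 φ)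

end Potential

section Representative

variable {S T : 𝔼 d → ℝ}

theorem freqWeight_smul_freqWeight_neg_smul (a : ℝ) {ξ : 𝔼 d} (hξ : ξ ≠ 0) (z : ℂ) :
    freqWeight a ξ • freqWeight (-a) ξ • z = z := by
  rw [smul_smul, mul_comm, freqWeight_neg_mul_freqWeight a hξ, one_smul]

theorem exists_homSobolev_of_tendsto (hs : 0 < s) (hsd : s < (d : ℝ) / 2) (hT : Measurable T)
    (hTl : LocallyIntegrable T) (hE : lrieszEnergy (2 * s) (fun x => ‖T x‖ₑ) ≠ ⊤)
    {h : Lp (α := 𝔼 d) ℂ 2 volume}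
    (hh : Tendsto (fun n => (memLp_weightedFourier_truncate hs hsd hT hTl hE n).toLp) atTop
      (nhds h)) :
    ∃ U : HomSobolev d s, U =ᵐ[volume] rieszPotential (2 * s) T ∧ HomSobolev.toL2 d s U = h := by
  have := neZero_of_lt_half hs hsd
  have hF := isDistribFourier_rieszPotential hs hsd hT hTl hE hh
  have hae : (fun ξ => freqWeight s ξ • freqWeight (-s) ξ • h ξ) =ᵐ[volume] h :=
    ae_ne_zero.mono fun ξ hξ => freqWeight_smul_freqWeight_neg_smul s hξ (h ξ)
  have hfin : HasFiniteHomNorm s (rieszPotential (2 * s) T) :=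
    ⟨_, hF, (memLp_two_freqWeight_smul_iff hF.1.aestronglyMeasurable).1
      ((memLp_congr_ae hae).2 (Lp.memLp h))⟩
  have hU := HomSobolev.coeFn_ofMemLp (memLp_rieszPotential hs hsd hT hE) hfin
  exact ⟨_, hU, Lp.ext ((HomSobolev.coeFn_toL2_of_ae_eq hU hF).trans hae)⟩

theorem conj_fourier_test {φ : 𝔼 d → ℝ} (hφ : ContDiff ℝ ∞ φ) (hc : HasCompactSupport φ)
    (ξ : 𝔼 d) : conj ((𝓕 (testToSchwartz hφ hc)) ξ) = (𝓕⁻ (testToSchwartz hφ hc)) ξ := by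
  rw [SchwartzMap.fourierInv_coe, Real.fourierInv_eq_fourier_neg, SchwartzMap.fourier_coe]
  exact (fourier_ofReal_neg φ ξ).symm

theorem integral_fourier_mul_conj_fourier_test (hS : Integrable S) {φ : 𝔼 d → ℝ}
    (hφ : ContDiff ℝ ∞ φ) (hc : HasCompactSupport φ) :
    ∫ ξ, 𝓕 (fun x => (S x : ℂ)) ξ * conj ((𝓕 (testToSchwartz hφ hc)) ξ) =
      ((∫ x, S x * φ x : ℝ) : ℂ) := by
  have hSc : Integrable fun x => (S x : ℂ) := hS.ofReal
  simp_rw [conj_fourier_test]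
  rw [integral_fourier_mul_eq_of_integrable hSc (𝓕⁻ (testToSchwartz hφ hc)).integrable,
    ← SchwartzMap.fourier_coe, FourierTransform.fourier_fourierInv_eq, ← integral_complex_ofReal]
  simp

theorem inner_toLp_weightedFourier_toL2_test [NeZero d] (hSi : Integrable S)
    (hS : MemLp (weightedFourier s S) 2) {φ : 𝔼 d → ℝ} (hφ : ContDiff ℝ ∞ φ)
    (hc : HasCompactSupport φ) {v : HomSobolev d s} (hv : v =ᵐ[volume] φ) :
    inner ℝ hS.toLp (HomSobolev.toL2 d s v) = ∫ x, S x * φ x := by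
  have hinner : (fun ξ => inner ℝ (hS.toLp _ ξ) (HomSobolev.toL2 d s v ξ)) =ᵐ[volume]
      fun ξ => (𝓕 (fun x => (S x : ℂ)) ξ * conj ((𝓕 (testToSchwartz hφ hc)) ξ)).re := by
    filter_upwards [hS.coeFn_toLp, ae_ne_zero,
      HomSobolev.coeFn_toL2_of_ae_eq hv (isDistribFourier_test hφ hc)] with ξ hSξ hξ hvξ
    rw [hSξ, hvξ, weightedFourier, real_inner_smul_left, real_inner_smul_right, ← mul_assoc,
      freqWeight_neg_mul_freqWeight s hξ, one_mul, real_inner_comm, Complex.inner]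
  have hSc : Integrable fun x => (S x : ℂ) := hSi.ofReal
  have hi : Integrable fun ξ =>
      𝓕 (fun x => (S x : ℂ)) ξ * conj ((𝓕 (testToSchwartz hφ hc)) ξ) :=
    (integrable_conj (𝓕 (testToSchwartz hφ hc)).integrable).bdd_mul
      (continuous_fourier_of_integrable hSc).aestronglyMeasurable
      (Eventually.of_forall (norm_fourier_le _))
  rw [L2.inner_def, integral_congr_ae hinner]
  refine (integral_re hi).trans ?_
  rw [integral_fourier_mul_conj_fourier_test hSi hφ hc]
  exact Complex.ofReal_re _

theorem exists_homSobolev_rieszPotential (hs : 0 < s) (hsd : s < (d : ℝ) / 2)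
    (hT : Measurable T) (hTl : LocallyIntegrable T)
    (hE : lrieszEnergy (2 * s) (fun x => ‖T x‖ₑ) ≠ ⊤) :
    ∃ U : HomSobolev d s, U =ᵐ[volume] rieszPotential (2 * s) T ∧
      ‖U‖ ^ 2 = rieszEnergy (2 * s) T ∧ HomSobolev.Extends (innerSL ℝ U) T := by
  have := neZero_of_lt_half hs hsd
  obtain ⟨h, hnorm, hh⟩ := exists_tendsto_weightedFourier_truncate hs hsd hT hTl hE
  obtain ⟨U, hU, hUh⟩ := exists_homSobolev_of_tendsto hs hsd hT hTl hE hh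
  refine ⟨U, hU, by rw [← (HomSobolev.toL2 d s).norm_map, hUh, hnorm], fun φ hφ hc => ?_⟩
  obtain ⟨v, hv⟩ := HomSobolev.exists_test hs hφ hc
  have hTφ : Integrable fun x => T x * φ x := by
    simpa only [smul_eq_mul, mul_comm] using
      hTl.integrable_smul_right_of_hasCompactSupport hφ.continuous hc
  have hlim := (hh.inner tendsto_const_nhds).congr fun n =>
    inner_toLp_weightedFourier_toL2_test (integrable_truncate hTl n)
      (memLp_weightedFourier_truncate hs hsd hT hTl hE n) hφ hc hv
  refine ⟨v, hv, ?_⟩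
  rw [innerSL_apply_apply, ← (HomSobolev.toL2 d s).inner_map_map, hUh]
  exact tendsto_nhds_unique hlim (tendsto_integral_truncate_mul hT hφ.continuous.measurable hTφ)

end Representative

section AlmostEverywhere

variable {S T : 𝔼 d → ℝ}

theorem rieszPotential_congr_ae (α : ℝ) (h : S =ᵐ[volume] T) :
    rieszPotential α S = rieszPotential α T :=
  funext fun _ => integral_congr_ae (h.mono fun y hy => by simp only [hy])

theorem rieszEnergy_congr_ae (α : ℝ) (h : S =ᵐ[volume] T) : rieszEnergy α S = rieszEnergy α T := by
  rw [rieszEnergy, rieszEnergy, rieszPotential_congr_ae α h]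
  exact integral_congr_ae (h.mono fun x hx => by simp only [hx])

theorem rieszAbsEnergy_congr_ae (α : ℝ) (h : S =ᵐ[volume] T) :
    rieszAbsEnergy α S = rieszAbsEnergy α T := by
  have hpot : ∀ x, ∫⁻ y, ENNReal.ofReal (rieszKernel d α (x - y)) * ENNReal.ofReal |S y| =
      ∫⁻ y, ENNReal.ofReal (rieszKernel d α (x - y)) * ENNReal.ofReal |T y| := fun x =>
    lintegral_congr_ae (h.mono fun y hy => by simp only [hy])
  simp only [rieszAbsEnergy, hpot]
  exact lintegral_congr_ae (h.mono fun x hx => by simp only [hx])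

theorem HomSobolev.Extends.congr_ae {L : StrongDual ℝ (HomSobolev d s)}
    (hL : HomSobolev.Extends L S) (h : S =ᵐ[volume] T) : HomSobolev.Extends L T :=
  fun φ hφ hc => (hL φ hφ hc).imp fun _ hv =>
    ⟨hv.1, hv.2.trans (integral_congr_ae (h.mono fun x hx => by simp only [hx]))⟩

end AlmostEverywhere

end RieszPotential

theorem lemma5p1_general {d : ℕ} {s : ℝ} (hs : 0 < s) (hsd : s < (d : ℝ) / 2)
    {T : EuclideanSpace ℝ (Fin d) → ℝ} (hT : LocallyIntegrable T)
    (hfin : rieszAbsEnergy (2 * s) T < ⊤) :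
    (∀ᵐ x, Integrable (fun y => rieszKernel d (2 * s) (x - y) * T y)) ∧
    Integrable (fun x => rieszPotential (2 * s) T x * T x) ∧
    ∃ L : StrongDual ℝ (HomSobolev d s),
      HomSobolev.Extends L T ∧
      (∀ L' : StrongDual ℝ (HomSobolev d s), HomSobolev.Extends L' T → L' = L) ∧
      (∃ U : HomSobolev d s,
        (∀ v, L v = inner ℝ U v) ∧
        (∀ U' : HomSobolev d s, (∀ v, L v = inner ℝ U' v) → U' = U) ∧
        U =ᵐ[volume] rieszPotential (2 * s) T) ∧
      ‖L‖ ^ 2 = rieszEnergy (2 * s) T := by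
  have := neZero_of_lt_half hs hsd
  obtain ⟨S, hS, hTS⟩ := hT.aestronglyMeasurable.aemeasurable
  rw [rieszAbsEnergy_congr_ae _ hTS, rieszAbsEnergy_eq_lrieszEnergy] at hfin
  obtain ⟨U, hU, hnorm, hext⟩ := exists_homSobolev_rieszPotential hs hsd hS (hT.congr hTS) hfin.ne
  have hext := hext.congr_ae hTS.symm
  have h0 : 0 ≤ 2 * s := by linarith
  have hd : 2 * s ≤ d := by linarith
  rw [rieszPotential_congr_ae _ hTS, rieszEnergy_congr_ae _ hTS]
  refine ⟨?_, ?_, innerSL ℝ U, hext, fun L' hL' => hext.unique hs hL', ⟨U, fun _ => rfl,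
    fun U' hU' => HomSobolev.eq_of_inner_eq hs hsd fun v => (hU' v).symm, hU⟩, ?_⟩
  · filter_upwards [ae_lrieszPotential_ne_top hs hsd hS.enorm hfin.ne] with x hx
    exact (integrable_rieszKernel_mul h0 hd hS hx).congr
      (hTS.symm.mono fun y hy => by simp only [hy])
  · exact (integrable_rieszPotential_mul h0 hd hS hfin.ne).congr
      (hTS.symm.mono fun x hx => by simp only [hx])
  · rw [innerSL_apply_norm, hnorm]

theorem lemma5p1 (d : ℕ) (hd : 2 ≤ d) (s : ℝ) (hs : 0 < s) (hsd : s < (d : ℝ) / 2)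
    (T : EuclideanSpace ℝ (Fin d) → ℝ) (hT : LocallyIntegrable T)
    (hfin : rieszAbsEnergy (2 * s) T < ⊤) :
    -- the integrals in `I_{2s} * T` and in `𝓓_{2s}(T, T)` converge absolutely
    (∀ᵐ x, Integrable (fun y => rieszKernel d (2 * s) (x - y) * T y)) ∧
    Integrable (fun x => rieszPotential (2 * s) T x * T x) ∧
    -- `T` generates a unique continuous linear functional `L` on the Sobolev space,
    ∃ L : StrongDual ℝ (HomSobolev d s),
      HomSobolev.Extends L T ∧ (∀ L' : StrongDual ℝ (HomSobolev d s), HomSobolev.Extends L' T → L' = L) ∧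
      -- it has a unique Riesz representative `U`, and `U = I_{2s} * T` almost everywhere,
      (∃ U : HomSobolev d s,
        (∀ v, L v = inner ℝ U v) ∧
        (∀ U' : HomSobolev d s, (∀ v, L v = inner ℝ U' v) → U' = U) ∧
        U =ᵐ[volume] rieszPotential (2 * s) T) ∧
      -- and the square of its dual norm is the energy
      ‖L‖ ^ 2 = rieszEnergy (2 * s) T :=
  lemma5p1_general hs hsd hT hfin
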